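/- Let $M$ be a smooth $n$-manifold, let $g(t)$, $t\in[0,T)$, be a smooth solution of the Ricci flow $\frac{\partial}{\partial t}g_{ij}=-2R_{ij}$ on $M$, and let $h(t)$, $t\in[0,T)$, be a smooth family of symmetric 2-tensors satisfying $$\frac{\partial}{\partial t}h_{ij}=\Delta h_{ij}+2R_{pijq}h_{pq}-R_{iq}h_{jq}-R_{jq}h_{iq},$$ where $\nabla$, $\Delta=g^{ij}\nabla_i\nabla_j$ and the curvatures are those of $g(t)$. Conventions: $R_{ijk}^l=\partial_i\Gamma_{jk}^l-\partial_j\Gamma_{ik}^l+\Gamma_{jk}^p\Gamma_{ip}^l-\Gamma_{ik}^p\Gamma_{jp}^l$, $R_{ijkl}=g_{lm}R_{ijk}^m$, $R_{jk}=R_{pjk}^p$, $R=g^{jk}R_{jk}$, $\operatorname{div}(h)_j=g^{pq}\nabla_p h_{qj}$; repeated lower indices are contracted with the inverse metric. On $\tilde M=M\times[0,T)$ use coordinates $x^0=t$ and local coordinates $x^1,\dots,x^n$ of $M$; time derivatives at $t=0$ are one-sided. Define, for $i,j,k\ge 1$, - the degenerate metric on $T^*\tilde M$: $\tilde g^{ij}=g^{ij}$,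 $\tilde g^{0j}=\tilde g^{j0}=\tilde g^{00}=0$; - the connection $\tilde\nabla$ with coefficients $\tilde\Gamma_{ij}^k=\Gamma_{ij}^k$, $\tilde\Gamma_{i0}^k=\tilde\Gamma_{0i}^k=-R_i^k$, $\tilde\Gamma_{00}^k=-\frac12\nabla^kR$, and $\tilde\Gamma_{ab}^0=0$ for all $a,b\ge0$; - the symmetric 2-tensor $\tilde h$: $\tilde h_{ij}=h_{ij}$, $\tilde h_{0j}=\tilde h_{j0}=\operatorname{div}(h)_j$, $\tilde h_{00}=\operatorname{div}(\operatorname{div}(h))+R_{pq}h_{pq}$. Let $\tilde R_{abc}^d$ and $\tilde R_{bc}=\tilde R_{abc}^a$ be the curvature and Ricci tensors of $\tilde\nabla$ (by the same formulas as above) and $\tilde\Delta=\tilde g^{ab}\tilde\nabla_a\tilde\nabla_b$. Then at every point of $\tilde M$ and for all $i,j\in\{0,\dots,n\}$, $$\tilde\nabla_0\tilde h_{ij}=\tilde\Delta\tilde h_{ij}+2\,\tilde g^{pr}\tilde h_{rq}\tilde R_{pij}^q,$$ or equivalently $$\frac{\partial}{\partial t}\tilde h_{ij}=\tilde\Delta_L\tilde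 h_{ij}:=\tilde\Delta\tilde h_{ij}+2\,\tilde g^{pr}\tilde h_{rq}\tilde R_{pij}^q-\tilde g^{qr}\tilde R_{iq}\tilde h_{jr}-\tilde g^{qr}\tilde R_{jq}\tilde h_{ir}.$$ (For every symmetric space-time 2-tensor in place of $\tilde h$ the two equations are equivalent, at each point and for each pair of indices.) -/

import Mathlib

open Set Bundle
open scoped Manifold ContDiff

namespace RicciSpaceTime

noncomputable section

/-! ### Tensor calculus in a coordinate frame

The same formulas serve the evolving space metric (indices `Fin n`) and the degenerate space-time
metric (indices `Fin (n + 1)`), so the two Laplacians, curvatures, and so on are defined once. -/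

/-- Local data on a coordinate domain `X`, with indices in `ι`: the coordinate derivations `∂_a`,
the coefficients `Γ i j k = Γ_{ij}^k` of a connection and the components `ginv a b = g^{ab}` of a
(possibly degenerate) symmetric form on the cotangent spaces. -/
structure LocalGeometry (ι X : Type) where
  D : ι → (X → ℝ) → X → ℝ
  Γ : ι → ι → ι → X → ℝ
  ginv : ι → ι → X → ℝ

namespace LocalGeometry

variable {ι X : Type} [Fintype ι] (G : LocalGeometry ι X)

/-- `∇_a α_i` for a 1-form `α`. -/
def nabla1 (α : ι → X → ℝ) (a i : ι) : X → ℝ := fun x =>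
  G.D a (α i) x - ∑ p, G.Γ a i p x * α p x

/-- `∇_a S_{ij}` for a covariant 2-tensor `S`. -/
def nabla2 (S : ι → ι → X → ℝ) (a i j : ι) : X → ℝ := fun x =>
  G.D a (S i j) x - ∑ p, G.Γ a i p x * S p j x - ∑ p, G.Γ a j p x * S i p x

/-- `∇_a A_{bij}` for a covariant 3-tensor `A`. -/
def nabla3 (A : ι → ι → ι → X → ℝ) (a b i j : ι) : X → ℝ := fun x =>
  G.D a (A b i j) x - ∑ p, G.Γ a b p x * A p i j x
    - ∑ p, G.Γ a i p x * A b p j x - ∑ p, G.Γ a j p x * A b i p x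

/-- The rough Laplacian `Δ S_{ij} = g^{ab} ∇_a ∇_b S_{ij}` of a covariant 2-tensor. -/
def laplacian (S : ι → ι → X → ℝ) (i j : ι) : X → ℝ := fun x =>
  ∑ a, ∑ b, G.ginv a b x * G.nabla3 (G.nabla2 S) a b i j x

/-- The curvature `R_{ijk}^l = ∂_i Γ_{jk}^l - ∂_j Γ_{ik}^l + Γ_{jk}^p Γ_{ip}^l - Γ_{ik}^p Γ_{jp}^l`
of the connection. -/
def riemann (i j k l : ι) : X → ℝ := fun x =>
  G.D i (G.Γ j k l) x - G.D j (G.Γ i k l) x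
    + ∑ p, G.Γ j k p x * G.Γ i p l x - ∑ p, G.Γ i k p x * G.Γ j p l x

/-- The Ricci tensor `R_{jk} = R_{pjk}^p`. -/
def ricci (j k : ι) : X → ℝ := fun x => ∑ p, G.riemann p j k p x

/-- The curvature term `S_{pq} R_{pij}^q`, that is `g^{pr} S_{rq} R_{pij}^q`.
For a nondegenerate metric this is `R_{pijq} S_{pq}`. -/
def curvatureTerm (S : ι → ι → X → ℝ) (i j : ι) : X → ℝ := fun x =>
  ∑ p, ∑ r, ∑ q, G.ginv p r x * S r q x * G.riemann p i j q x

/-- The Lichnerowicz Laplacian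
`Δ_L S_{ij} = Δ S_{ij} + 2 S_{pq} R_{pij}^q - R_{iq} S_{jq} - R_{jq} S_{iq}`,
a repeated lower index `q` being contracted with `g^{qr}`. -/
def lichnerowicz (S : ι → ι → X → ℝ) (i j : ι) : X → ℝ := fun x =>
  G.laplacian S i j x + 2 * G.curvatureTerm S i j x
    - ∑ q, ∑ r, G.ginv q r x * G.ricci i q x * S j r x
    - ∑ q, ∑ r, G.ginv q r x * G.ricci j q x * S i r x

/-- The scalar curvature `R = g^{ij} R_{ij}`. -/
def scalar : X → ℝ := fun x => ∑ i, ∑ j, G.ginv i j x * G.ricci i j x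

/-- The divergence `div(S)_j = g^{pq} ∇_p S_{qj}` of a 2-tensor. -/
def div2 (S : ι → ι → X → ℝ) (j : ι) : X → ℝ := fun x =>
  ∑ p, ∑ q, G.ginv p q x * G.nabla2 S p q j x

/-- The divergence `div(α) = g^{pq} ∇_p α_q` of a 1-form. -/
def div1 (α : ι → X → ℝ) : X → ℝ := fun x =>
  ∑ p, ∑ q, G.ginv p q x * G.nabla1 α p q x

/-- The inner product `Rc · S = g^{ip} g^{jq} R_{ij} S_{pq}`. -/
def ricciDot (S : ι → ι → X → ℝ) : X → ℝ := fun x =>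
  ∑ i, ∑ j, ∑ p, ∑ q, G.ginv i p x * G.ginv j q x * G.ricci i j x * S p q x

end LocalGeometry

/-! ### Time-dependent tensors on a manifold and their components -/

/-- `ℝⁿ`, the model of an `n`-manifold. -/
abbrev E (n : ℕ) : Type := EuclideanSpace ℝ (Fin n)

section Manifold

variable {n : ℕ} {M : Type*} [TopologicalSpace M] [ChartedSpace (E n) M]

variable (n M) in
/-- Time-dependent covariant 2-tensors on `M`. -/
abbrev TimeTensor : Type _ :=
  ℝ → (x : M) → TangentSpace (𝓡 n) x →L[ℝ] TangentSpace (𝓡 n) x →L[ℝ] ℝ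

variable (n M) in
/-- Time-dependent Riemannian metrics on `M`. -/
abbrev TimeMetric [IsManifold (𝓡 n) ∞ M] : Type _ :=
  ℝ → ContMDiffRiemannianMetric (𝓡 n) ∞ (E n) (fun x : M => TangentSpace (𝓡 n) x)

/-- A time-dependent metric as a time-dependent 2-tensor. -/
def TimeMetric.tensor [IsManifold (𝓡 n) ∞ M] (g : TimeMetric n M) : TimeTensor n M :=
  fun t x => (g t).inner x

/-- The coordinate vector `∂/∂xⁱ` of the chart `e` at the point with coordinates `y`. -/
def coordVector (e : OpenPartialHomeomorph M (E n)) (y : E n) (i : Fin n) :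
    TangentSpace (𝓡 n) (e.symm y) :=
  mfderiv (𝓡 n) (𝓡 n) e.symm y (EuclideanSpace.single i (1 : ℝ) : E n)

/-- The components `S_{ij}(t, y) = S(∂/∂xⁱ, ∂/∂xʲ)` in the chart `e`. -/
def components (e : OpenPartialHomeomorph M (E n)) (S : TimeTensor n M) (i j : Fin n) :
    ℝ × E n → ℝ := fun z =>
  S z.1 (e.symm z.2) (coordVector e z.2 i) (coordVector e z.2 j)

/-- Joint smoothness on `M × [0, T)`, up to the initial time: the components in every chart of the
smooth structure are smooth functions of time and position. -/
def IsSmoothOn (T : ℝ) (S : TimeTensor n M) : Prop :=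
  ∀ e ∈ IsManifold.maximalAtlas (𝓡 n) ∞ M, ∀ i j : Fin n,
    ContDiffOn ℝ ∞ (components e S i j) (Ico 0 T ×ˢ e.target)

/-- The time derivative on `[0, T)`, one-sided at the initial time. -/
def timeDeriv (T : ℝ) (f : ℝ × E n → ℝ) : ℝ × E n → ℝ := fun z =>
  derivWithin (fun s => f (s, z.2)) (Ico 0 T) z.1

/-- The partial derivative `∂/∂xᵃ` at fixed time. -/
def spaceDeriv (a : Fin n) (f : ℝ × E n → ℝ) : ℝ × E n → ℝ := fun z =>
  fderiv ℝ (fun y => f (z.1, y)) z.2 (EuclideanSpace.single a (1 : ℝ))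

variable [IsManifold (𝓡 n) ∞ M]

/-- The inverse metric `g^{ij}` in the chart `e`. -/
def inverseMetric (g : TimeMetric n M) (e : OpenPartialHomeomorph M (E n)) (i j : Fin n) :
    ℝ × E n → ℝ := fun z =>
  (Matrix.of fun a b => components e g.tensor a b z)⁻¹ i j

/-- The Christoffel symbols `Γ_{ij}^k = ½ g^{kl} (∂_i g_{jl} + ∂_j g_{il} - ∂_l g_{ij})`. -/
def christoffel (g : TimeMetric n M) (e : OpenPartialHomeomorph M (E n)) (i j k : Fin n) :
    ℝ × E n → ℝ := fun z =>
  (1 / 2 : ℝ) * ∑ l, inverseMetric g e k l z *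
    (spaceDeriv i (components e g.tensor j l) z + spaceDeriv j (components e g.tensor i l) z
      - spaceDeriv l (components e g.tensor i j) z)

/-- The geometry of the evolving metric `g(t)` in the chart `e`: spatial derivatives, the
Levi-Civita connection of `g(t)` and the inverse of `g(t)`. -/
def space (g : TimeMetric n M) (e : OpenPartialHomeomorph M (E n)) :
    LocalGeometry (Fin n) (ℝ × E n) where
  D := spaceDeriv
  Γ := christoffel g e
  ginv := inverseMetric g e

/-- A smooth solution `∂g_{ij}/∂t = -2 R_{ij}` of the Ricci flow on `M × [0, T)`. -/
def IsRicciFlow (T : ℝ) (g : TimeMetric n M) : Prop :=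
  IsSmoothOn T g.tensor ∧
  ∀ e ∈ IsManifold.maximalAtlas (𝓡 n) ∞ M, ∀ t ∈ Ico 0 T, ∀ y ∈ e.target, ∀ i j : Fin n,
    timeDeriv T (components e g.tensor i j) (t, y) = -2 * (space g e).ricci i j (t, y)

/-- A smooth symmetric solution on `M × [0, T)` of the Lichnerowicz heat equation
`∂h_{ij}/∂t = Δ h_{ij} + 2 R_{pijq} h_{pq} - R_{iq} h_{jq} - R_{jq} h_{iq}`
with respect to the evolving metric `g(t)`. -/
def IsLichnerowiczHeatFlow (T : ℝ) (g : TimeMetric n M) (h : TimeTensor n M) : Prop :=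
  IsSmoothOn T h ∧
  (∀ t ∈ Ico 0 T, ∀ (x : M) (v w : TangentSpace (𝓡 n) x), h t x v w = h t x w v) ∧
  ∀ e ∈ IsManifold.maximalAtlas (𝓡 n) ∞ M, ∀ t ∈ Ico 0 T, ∀ y ∈ e.target, ∀ i j : Fin n,
    timeDeriv T (components e h i j) (t, y)
      = (space g e).lichnerowicz (components e h) i j (t, y)

/-! ### Space-time `M × [0, T)`

Space-time indices are `Fin (n + 1)`: the index `0` is the time coordinate `x⁰ = t`, the index
`i.succ` is the `i`-th coordinate of the chart `e`. -/

/-- The mixed Ricci tensor `R_i^k = g^{kp} R_{ip}`. -/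
def mixedRicci (g : TimeMetric n M) (e : OpenPartialHomeomorph M (E n)) (i k : Fin n) :
    ℝ × E n → ℝ := fun z =>
  ∑ p, inverseMetric g e k p z * (space g e).ricci i p z

/-- The gradient `∇^k R = g^{kp} ∂_p R` of the scalar curvature. -/
def gradScalar (g : TimeMetric n M) (e : OpenPartialHomeomorph M (E n)) (k : Fin n) :
    ℝ × E n → ℝ := fun z =>
  ∑ p, inverseMetric g e k p z * spaceDeriv p (space g e).scalar z

/-- The coefficients of the space-time connection: `Γ̃_{ij}^k = Γ_{ij}^k`,
`Γ̃_{i0}^k = Γ̃_{0i}^k = -R_i^k` and `Γ̃_{00}^k = -½ ∇^k R` for spatial `i, j, k`,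
and `Γ̃_{ab}^0 = 0` for all `a, b`. -/
def spaceTimeConnection (g : TimeMetric n M) (e : OpenPartialHomeomorph M (E n))
    (a b c : Fin (n + 1)) : ℝ × E n → ℝ :=
  Fin.cases (fun _ => 0)
    (fun k =>
      Fin.cases
        (Fin.cases (fun z => -(1 / 2 : ℝ) * gradScalar g e k z)
          (fun j z => -mixedRicci g e j k z) b)
        (fun i => Fin.cases (fun z => -mixedRicci g e i k z)
          (fun j => christoffel g e i j k) b) a) c

/-- The degenerate metric on the cotangent bundle of space-time: `g̃^{ij} = g^{ij}` for spatial
`i, j`, and `0` if one of the indices is `0`. -/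
def degenerateMetric (g : TimeMetric n M) (e : OpenPartialHomeomorph M (E n))
    (a b : Fin (n + 1)) : ℝ × E n → ℝ :=
  Fin.cases (fun _ => 0)
    (fun i => Fin.cases (fun _ => 0) (fun j => inverseMetric g e i j) b) a

/-- The space-time geometry: `∂_0` is the time derivative, and the connection and the metric are the
degenerate ones on space-time. -/
def spaceTime (T : ℝ) (g : TimeMetric n M) (e : OpenPartialHomeomorph M (E n)) :
    LocalGeometry (Fin (n + 1)) (ℝ × E n) where
  D := Fin.cases (timeDeriv T) spaceDeriv
  Γ := spaceTimeConnection g e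
  ginv := degenerateMetric g e

/-- The space-time extension `h̃` of `h`: `h̃_{ij} = h_{ij}`, `h̃_{0j} = h̃_{j0} = div(h)_j` for
spatial `i, j`, and `h̃_{00} = div(div(h)) + Rc · h`. -/
def extension (g : TimeMetric n M) (h : TimeTensor n M) (e : OpenPartialHomeomorph M (E n))
    (a b : Fin (n + 1)) : ℝ × E n → ℝ :=
  Fin.cases
    (Fin.cases
      (fun z => (space g e).div1 ((space g e).div2 (components e h)) z
        + (space g e).ricciDot (components e h) z)
      (fun j => (space g e).div2 (components e h) j) b)
    (fun i => Fin.cases ((space g e).div2 (components e h) i)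
      (fun j => components e h i j) b) a

end Manifold

end

end RicciSpaceTime

/-!
The space-time geometry `(g̃^{ab}, ∇̃)` has three structural properties, valid for all space-time
indices: `∇̃` is torsion-free, the degenerate form `g̃^{ab}` is parallel (in the time direction this
is the Ricci flow equation), and the vector field `X = ∂_t` satisfies `∇̃_a X^c = -R̃_a^c`, like the
gradient field of a steady soliton (`TimeEvolution.nab_timeField`; for `a = 0` this uses the
contracted second Bianchi identity). The last property says `Γ̃_{0a}^c = -R̃_a^c`, which is the
equivalence of the two equations.

The extension `h̃` is characterised by `X^c h̃_{cb} = g̃^{pq} ∇̃_p h̃_{qb}` for all `b`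
(`TimeEvolution.contract_extTensor`). Let `E = ∇̃_X h̃ - Δ̃h̃ - 2 R̃m(h̃)`. The core of the argument
is that `E` inherits this property, `X^c E_{cb} = g̃^{pq} ∇̃_p E_{qb}` (`div_heatOp_eq`). As the
spatial components of `E` vanish by the equation for `h`, so do then the components `E_{0j}`, and
finally `E_{00}`. No evolution equation for the curvature is needed.

To prove the inheritance, `h` is regarded as a 1-form with values in a module `W` with connection of
curvature `F`, the second index being hidden in `W`. Commuting derivatives leaves
(`Connection.div_heatOp`) only the error term `g^{pq} (g^{ac} (∇_a F)_{pc} - X^c F_{pc}) h_q`, which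
for `W` the 1-forms is `g^{pq} Θ_{pb}^r h_{qr}` with
`Θ_{pb}^r = X^c R_{pcb}^r - g^{ac} ∇_a R_{pcb}^r`. The two Bianchi identities and the equation for
`∇X` make `Θ` symmetric in `p, b` (`curvDefect_symm`), and `g^{bq} Θ_{pb}^r` is skew in `q, r`
(`curvDefect_skew`). So the error term is the contraction of a skew tensor with a symmetric one.

All of this is algebra over a ring with commuting derivations. It is applied to the ring of smooth
functions on `[0, T) × U` for a chart domain `U`, with time derivatives one-sided at `0`.
-/

namespace RicciSpaceTime

noncomputable section

section Contract

variable {ι A W : Type*} [Fintype ι] [CommRing A] [AddCommGroup W] [Module A W]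

/-- The contraction `X^c h_c` of a vector with a `W`-valued 1-form. -/
def contract (X : ι → A) (h : ι → W) : W := ∑ c, X c • h c

lemma contract_sub (X : ι → A) (h h' : ι → W) :
    contract X (fun c => h c - h' c) = contract X h - contract X h' := by
  simp [contract, Finset.sum_sub_distrib, smul_sub]

lemma contract_add (X : ι → A) (h h' : ι → W) :
    contract X (fun c => h c + h' c) = contract X h + contract X h' := by
  simp [contract, Finset.sum_add_distrib]

lemma contract_contract_swap (X Y : ι → A) (S : ι → ι → W) :
    contract X (fun c => contract Y (S c)) = contract Y (fun q => contract X fun c => S c q) := by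
  simp only [contract, Finset.smul_sum]
  rw [Finset.sum_comm]
  simp only [smul_comm (X _)]

end Contract

/-! ### Connections over a ring with commuting derivations -/

/-- Tensor calculus in a coordinate frame over an abstract ring `A`, which plays the role of the
smooth functions on the domain of a chart: commuting derivations `D a` (the coordinate derivatives),
the coefficients `Γ a b c = Γ_{ab}^c` of a torsion-free connection, and the components
`ginv a b = g^{ab}` of a parallel symmetric form on covectors, which may be degenerate. -/
structure FrameGeometry (ι A : Type*) [Fintype ι] [CommRing A] [Algebra ℝ A] where
  D : ι → Derivation ℝ A A
  D_comm : ∀ a b f, D a (D b f) = D b (D a f)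
  Γ : ι → ι → ι → A
  Γ_symm : ∀ a b c, Γ a b c = Γ b a c
  ginv : ι → ι → A
  ginv_symm : ∀ a b, ginv a b = ginv b a
  ginv_parallel : ∀ c a b,
    D c (ginv a b) + ∑ p, Γ c p a * ginv p b + ∑ p, Γ c p b * ginv a p = 0

namespace FrameGeometry

variable {ι A : Type*} [Fintype ι] [CommRing A] [Algebra ℝ A] (G : FrameGeometry ι A)

/-- A connection on the `A`-module `W`: operators `∇_a` on `W` obeying the Leibniz rule. When `W`
consists of arrays of tensor components, `nab a` is `∇_a` acting on the indices of these arrays. -/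
structure Connection (W : Type*) [AddCommGroup W] [Module A W] where
  nab : ι → W →+ W
  leibniz : ∀ a (f : A) w, nab a (f • w) = G.D a f • w + f • nab a w

/-- The curvature `R_{ijk}^l`, with the sign convention of `LocalGeometry.riemann`. -/
def riem (i j k l : ι) : A :=
  G.D i (G.Γ j k l) - G.D j (G.Γ i k l)
    + ∑ p, G.Γ j k p * G.Γ i p l - ∑ p, G.Γ i k p * G.Γ j p l

variable {G} {W : Type*} [AddCommGroup W] [Module A W]

variable (G) in
/-- The trivial connection `∇_a = D_a` on functions. -/
def scalarConn : G.Connection A where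
  nab a := (G.D a : A →ₗ[ℝ] A).toAddMonoidHom
  leibniz a f w := by simp [add_comm, mul_comm]

@[simp] lemma scalarConn_nab (a : ι) (f : A) : G.scalarConn.nab a f = G.D a f := rfl

namespace Connection

/-- The connection on `W`-valued 1-forms, `∇_a T_i - Γ_{ai}^p T_p`. Iterating `lower` and `upper`
from `scalarConn` gives the covariant derivative of tensors of all types, the outermost operation
belonging to the first index. -/
def lower (C : G.Connection W) : G.Connection (ι → W) where
  nab a :=
    { toFun := fun T i => C.nab a (T i) - ∑ p, G.Γ a i p • T p
      map_zero' := by ext; simp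
      map_add' := fun S T => by
        ext i; simp only [Pi.add_apply, map_add, smul_add, Finset.sum_add_distrib]; abel }
  leibniz a f T := by
    ext i
    simp only [AddMonoidHom.coe_mk, ZeroHom.coe_mk, Pi.smul_apply, C.leibniz, Pi.add_apply,
      smul_sub, Finset.smul_sum, smul_comm f]
    abel

/-- The connection on `W`-valued vectors, `∇_a T^k + Γ_{ap}^k T^p`. -/
def upper (C : G.Connection W) : G.Connection (ι → W) where
  nab a :=
    { toFun := fun T k => C.nab a (T k) + ∑ p, G.Γ a p k • T p
      map_zero' := by ext; simp
      map_add' := fun S T => by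
        ext i; simp only [Pi.add_apply, map_add, smul_add, Finset.sum_add_distrib]; abel }
  leibniz a f T := by
    ext i
    simp only [AddMonoidHom.coe_mk, ZeroHom.coe_mk, Pi.smul_apply, C.leibniz, Pi.add_apply,
      smul_add, Finset.smul_sum, smul_comm f]
    abel

lemma lower_nab (C : G.Connection W) (a : ι) (T : ι → W) (i : ι) :
    C.lower.nab a T i = C.nab a (T i) - ∑ p, G.Γ a i p • T p := rfl

lemma upper_nab (C : G.Connection W) (a : ι) (T : ι → W) (k : ι) :
    C.upper.nab a T k = C.nab a (T k) + ∑ p, G.Γ a p k • T p := rfl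

/-- The curvature `F_{ab} = [∇_a, ∇_b]` of a connection, as an operator on `W`. The index `b` of the
inner derivative is not differentiated, which is why no `Γ_{ab}^c ∇_c` terms appear. -/
def curv (C : G.Connection W) (a b : ι) : W →+ W :=
  (C.nab a).comp (C.nab b) - (C.nab b).comp (C.nab a)

lemma curv_apply (C : G.Connection W) (a b : ι) (w : W) :
    C.curv a b w = C.nab a (C.nab b w) - C.nab b (C.nab a w) := rfl

lemma curv_antisymm (C : G.Connection W) (a b : ι) (w : W) : C.curv a b w = -C.curv b a w := by
  simp [curv_apply]

lemma curv_smul (C : G.Connection W) (a b : ι) (f : A) (w : W) :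
    C.curv a b (f • w) = f • C.curv a b w := by
  simp only [curv_apply, C.leibniz, map_add, G.D_comm a b f, smul_sub]
  abel

lemma scalar_curv (a b : ι) (f : A) : G.scalarConn.curv a b f = 0 := by
  simp [curv_apply, G.D_comm a b f]

lemma lower_curv (C : G.Connection W) (a b : ι) (T : ι → W) (i : ι) :
    C.lower.curv a b T i = C.curv a b (T i) - ∑ p, G.riem a b i p • T p := by
  have key : ∀ a b : ι, C.lower.nab a (C.lower.nab b T) i = C.nab a (C.nab b (T i))
      - ∑ p, G.D a (G.Γ b i p) • T p - ∑ p, G.Γ b i p • C.nab a (T p)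
      - ∑ p, G.Γ a i p • C.nab b (T p) + ∑ p, (∑ q, G.Γ a i q * G.Γ b q p) • T p := by
    intro a b
    simp only [lower_nab, map_sub, map_sum, C.leibniz, Finset.sum_add_distrib, smul_sub,
      Finset.smul_sum, Finset.sum_sub_distrib, Finset.sum_smul, mul_smul]
    rw [Finset.sum_comm (s := Finset.univ) (t := Finset.univ)
      (f := fun p q => G.Γ a i p • G.Γ b p q • T q)]
    abel
  simp only [curv_apply, Pi.sub_apply, key, riem, sub_smul, add_smul, Finset.sum_sub_distrib,
    Finset.sum_add_distrib]
  abel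

lemma upper_curv (C : G.Connection W) (a b : ι) (T : ι → W) (k : ι) :
    C.upper.curv a b T k = C.curv a b (T k) + ∑ p, G.riem a b p k • T p := by
  have key : ∀ a b : ι, C.upper.nab a (C.upper.nab b T) k = C.nab a (C.nab b (T k))
      + ∑ p, G.D a (G.Γ b p k) • T p + ∑ p, G.Γ b p k • C.nab a (T p)
      + ∑ p, G.Γ a p k • C.nab b (T p) + ∑ p, (∑ q, G.Γ b p q * G.Γ a q k) • T p := by
    intro a b
    simp only [upper_nab, map_add, map_sum, C.leibniz, Finset.sum_add_distrib, smul_add,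
      Finset.smul_sum, Finset.sum_smul, mul_smul]
    rw [Finset.sum_comm (s := Finset.univ) (t := Finset.univ)
      (f := fun p q => G.Γ a p k • G.Γ b q p • T q)]
    simp only [smul_comm (G.Γ a _ k) (G.Γ b _ _)]
    abel
  simp only [curv_apply, Pi.sub_apply, key, riem, sub_smul, add_smul, Finset.sum_sub_distrib,
    Finset.sum_add_distrib]
  abel

/-- The total covariant derivative `∇w`, a `W`-valued 1-form. -/
def grad (C : G.Connection W) (w : W) : ι → W := fun a => C.nab a w

lemma grad_apply (C : G.Connection W) (w : W) (a : ι) : C.grad w a = C.nab a w := rfl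

/-- The Ricci identity `∇_a∇_b w = ∇_b∇_a w + F_{ab} w`. -/
lemma lower_nab_grad_comm (C : G.Connection W) (a b : ι) (w : W) :
    C.lower.nab a (C.grad w) b = C.lower.nab b (C.grad w) a + C.curv a b w := by
  simp only [lower_nab, grad_apply, curv_apply, G.Γ_symm a b]
  abel

end Connection

variable (G) in
/-- The trace `g^{pq} B_{pq}` of a `W`-valued bilinear form. -/
def tr (B : ι → ι → W) : W := ∑ p, ∑ q, G.ginv p q • B p q

lemma tr_add (B B' : ι → ι → W) :
    G.tr (fun p q => B p q + B' p q) = G.tr B + G.tr B' := by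
  simp [tr, Finset.sum_add_distrib]

lemma tr_sub (B B' : ι → ι → W) :
    G.tr (fun p q => B p q - B' p q) = G.tr B - G.tr B' := by
  simp [tr, Finset.sum_sub_distrib, smul_sub]

lemma tr_neg (B : ι → ι → W) : G.tr (fun p q => - B p q) = - G.tr B := by
  simp [tr]

lemma tr_smul (f : A) (B : ι → ι → W) : G.tr (fun p q => f • B p q) = f • G.tr B := by
  simp [tr, Finset.smul_sum, smul_comm f]

lemma tr_smul_const (f : ι → ι → A) (w : W) : G.tr (fun p q => f p q • w) = G.tr f • w := by
  simp [tr, Finset.sum_smul, mul_smul]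

lemma tr_sum {κ : Type*} (s : Finset κ) (B : κ → ι → ι → W) :
    G.tr (fun p q => ∑ r ∈ s, B r p q) = ∑ r ∈ s, G.tr (B r) := by
  simp only [tr, Finset.smul_sum]
  rw [Finset.sum_congr rfl fun _ _ => Finset.sum_comm, Finset.sum_comm]

lemma tr_swap (B : ι → ι → W) : G.tr (fun p q => B q p) = G.tr B := by
  simp only [tr]
  rw [Finset.sum_comm]
  simp only [G.ginv_symm]
  
lemma tr_tr (B : ι → ι → ι → ι → W) :
    G.tr (fun p q => G.tr (B p q)) = G.tr fun a c => G.tr fun p q => B p q a c := by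
  change ∑ p, ∑ q, G.ginv p q • G.tr (B p q)
    = G.tr fun a c => ∑ p, ∑ q, G.ginv p q • B p q a c
  simp only [tr_sum, tr_smul]

lemma tr_apply {κ : Type*} (B : ι → ι → κ → W) (i : κ) : G.tr B i = G.tr fun p q => B p q i := by
  simp [tr]

/-- Traces commute with covariant derivatives, as `g^{pq}` is parallel. -/
lemma nab_tr (C : G.Connection W) (c : ι) (B : ι → ι → W) :
    C.nab c (G.tr B) = G.tr fun p q => C.lower.lower.nab c B p q := by
  have h1 : ∀ p q, G.D c (G.ginv p q)
      = - ∑ r, G.Γ c r p * G.ginv r q - ∑ r, G.Γ c r q * G.ginv p r := fun p q => by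
    linear_combination G.ginv_parallel c p q
  simp only [tr, map_sum, C.leibniz, h1, Connection.lower_nab, Pi.sub_apply, Finset.sum_apply,
    Pi.smul_apply, smul_sub, sub_smul, neg_smul, Finset.sum_smul, Finset.smul_sum,
    Finset.sum_add_distrib, Finset.sum_sub_distrib, Finset.sum_neg_distrib, mul_smul]
  have h2 : ∑ p, ∑ q, ∑ r, G.Γ c r p • G.ginv r q • B p q
      = ∑ p, ∑ q, ∑ r, G.ginv p q • G.Γ c p r • B r q := by
    rw [Finset.sum_congr rfl fun _ _ => Finset.sum_comm, Finset.sum_comm,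
      Finset.sum_congr rfl fun _ _ => Finset.sum_comm]
    simp only [smul_comm (G.Γ c _ _)]
  have h3 : ∑ p, ∑ q, ∑ r, G.Γ c r q • G.ginv p r • B p q
      = ∑ p, ∑ q, ∑ r, G.ginv p q • G.Γ c q r • B p r := by
    rw [Finset.sum_congr rfl fun _ _ => Finset.sum_comm]
    simp only [smul_comm (G.Γ c _ _)]
  rw [h2, h3]
  abel

lemma Connection.lower_nab_swap (C : G.Connection W) (a : ι) (B : ι → ι → W) (p q : ι) :
    C.lower.lower.nab a (fun p q => B q p) p q = C.lower.lower.nab a B q p := by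
  simp only [Connection.lower_nab, Pi.sub_apply, Finset.sum_apply, Pi.smul_apply]
  abel

/-- The divergence `g^{pq} ∇_p h_q` of a `W`-valued 1-form. -/
def Connection.div (C : G.Connection W) (h : ι → W) : W := G.tr fun p q => C.lower.nab p h q

/-- The rough Laplacian `g^{pq} ∇_p ∇_q w`. -/
def Connection.lap (C : G.Connection W) (w : W) : W := C.div (C.grad w)

/-! ### The divergence of the heat operator -/

variable (G) in
/-- The mixed Ricci tensor, defined as `ρ_c^r = -g^{pq} R_{pcq}^r`. This is the form in which it
comes out of commuting derivatives; `mixedRic_eq_sharp` identifies it with `g^{rq} R_{cq}`. -/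
def mixedRic (c r : ι) : A := -G.tr fun p q => G.riem p c q r

lemma riem_antisymm (i j k l : ι) : G.riem i j k l = -G.riem j i k l := by
  simp only [riem]; ring

/-- The first Bianchi identity. -/
lemma riem_cyclic (i j k l : ι) : G.riem i j k l + G.riem j k i l + G.riem k i j l = 0 := by
  simp only [riem, G.Γ_symm k i, G.Γ_symm k j, G.Γ_symm j i]; ring

namespace Connection

/-- The covariant derivative `(∇_a F)_{pc}` of the curvature of `W`, as an operator on `W`. -/
def dcurv (C : G.Connection W) (a p c : ι) (w : W) : W :=
  C.nab a (C.curv p c w) - C.curv p c (C.nab a w) - ∑ s, G.Γ a p s • C.curv s c w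
    - ∑ s, G.Γ a c s • C.curv p s w

/-- `∇_a (g^{pq} B_{cpq}) = g^{pq} ∇_a B_{cpq}`, the trace being over the last two indices. -/
lemma lower_nab_tr_last (C : G.Connection W) (a c : ι) (B : ι → ι → ι → W) :
    C.lower.nab a (fun c => G.tr fun p q => B c p q) c
      = G.tr fun p q => C.lower.lower.lower.nab a B c p q := by
  have h1 : (fun c => G.tr fun p q => B c p q) = G.tr fun p q c => B c p q := by
    funext c; rw [tr_apply]
  rw [h1, nab_tr, tr_apply]
  congr 1; funext p q
  simp only [lower_nab, Pi.sub_apply, Finset.sum_apply, Pi.smul_apply]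
  abel

lemma lower_nab_tr_mid (C : G.Connection W) (a c : ι) (B : ι → ι → ι → W) :
    C.lower.nab a (fun c => G.tr fun p q => B p c q) c
      = G.tr fun p q => C.lower.lower.lower.nab a B p c q := by
  rw [lower_nab_tr_last C a c fun c p q => B p c q]
  congr 1; funext p q
  simp only [lower_nab, Pi.sub_apply, Finset.sum_apply, Pi.smul_apply]
  abel

/-- `ρ^{cr} T_{cr}` may be formed with `ρ` contracted into either index of `T`. -/
lemma tr_contract_mixedRic
    (hρ : ∀ a c, ∑ b, G.ginv a b * G.mixedRic b c = ∑ b, G.ginv c b * G.mixedRic b a)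
    (T : ι → ι → W) :
    (G.tr fun a c => contract (G.mixedRic a) (T c))
      = G.tr fun p q => contract (G.mixedRic p) fun r => T r q := by
  have e3 : (G.tr fun a c => contract (G.mixedRic a) (T c))
      = ∑ c, ∑ r, (∑ a, G.ginv c a * G.mixedRic a r) • T c r := by
    rw [← tr_swap]
    simp only [tr, contract, Finset.smul_sum, Finset.sum_smul, mul_smul]
    exact Finset.sum_congr rfl fun _ _ => Finset.sum_comm
  have e4 : (G.tr fun p q => contract (G.mixedRic p) fun r => T r q)
      = ∑ r, ∑ q, (∑ p, G.ginv q p * G.mixedRic p r) • T r q := by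
    rw [← tr_swap]
    simp only [tr, contract, Finset.smul_sum, Finset.sum_smul, mul_smul]
    rw [Finset.sum_congr rfl fun _ _ => Finset.sum_comm, Finset.sum_comm]
  rw [e3, e4]
  exact Finset.sum_congr rfl fun c _ => Finset.sum_congr rfl fun r _ => by rw [hρ]

/-- Commuting divergence and Laplacian: with `T = ∇h`,
`div (Δh) = Δ (div h) + g^{pq} g^{ac} F_{pa} T_{cq} + div Q`, where
`Q_c = g^{pq} F_{pc} h_q + ρ_c^r h_r`. -/
lemma div_lap (C : G.Connection W)
    (hρ : ∀ a c, ∑ b, G.ginv a b * G.mixedRic b c = ∑ b, G.ginv c b * G.mixedRic b a) (h : ι → W) :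
    C.div (C.lower.lap h) = C.lap (C.div h)
      + (G.tr fun p q => G.tr fun a c => C.curv p a (C.lower.nab c h q))
      + C.div (fun c => (G.tr fun p q => C.curv p c (h q)) + contract (G.mixedRic c) h) := by
  set T : ι → ι → W := C.lower.grad h with hT
  set H : ι → ι → ι → W := C.lower.lower.grad T with hH
  -- `K` is the commutator `∇_p∇_c h_q - ∇_c∇_p h_q`. Its trace over `p, q` is `Q`; tracing before
  -- differentiating avoids derivatives of the curvature.
  set K : ι → ι → ι → W := fun p c q => C.curv p c (h q) - ∑ r, G.riem p c q r • h r with hK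
  have hHK : H = (fun p c q => H c p q) + K := by
    funext p c q
    have := congrFun (C.lower.lower_nab_grad_comm p c h) q
    rw [Pi.add_apply, C.lower_curv] at this
    exact this
  have h1 : C.div (C.lower.lap h)
      = G.tr fun p q => G.tr fun a c => C.lower.lower.lower.nab p H a c q := by
    unfold div
    congr 1; funext p q
    change C.lower.nab p (G.tr H) q = _
    rw [nab_tr, tr_apply]
  have h2 : C.lap (C.div h)
      = G.tr fun p q => G.tr fun a c => C.lower.lower.lower.nab a H c p q := by
    rw [tr_tr]
    change G.tr _ = _
    congr 1; funext a c
    rw [← lower_nab_tr_last]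
    refine congrArg (fun f => C.lower.nab a f c) (funext fun c => ?_)
    exact nab_tr C c _
  have h3 : C.div (fun c => (G.tr fun p q => C.curv p c (h q)) + contract (G.mixedRic c) h)
      = G.tr fun p q => G.tr fun a c => C.lower.lower.lower.nab a K p c q := by
    rw [tr_tr]
    unfold div
    congr 1; funext a c
    rw [← lower_nab_tr_mid]
    refine congrArg (fun f => C.lower.nab a f c) (funext fun c => ?_)
    simp only [hK, contract, tr_sub, tr_sum, tr_smul_const, mixedRic, neg_smul,
      Finset.sum_neg_distrib]
    abel
  have h4 : ∀ p q a c, C.lower.lower.lower.nab p H a c q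
      = C.lower.lower.lower.nab a H c p q + C.lower.lower.lower.nab a K p c q
        + (C.curv p a (T c q) - ∑ r, G.riem p a q r • T c r - ∑ r, G.riem p a c r • T r q) := by
    intro p q a c
    have e1 : C.lower.lower.lower.nab p H a c q = C.lower.lower.lower.nab a H p c q
        + (C.curv p a (T c q) - ∑ r, G.riem p a q r • T c r - ∑ r, G.riem p a c r • T r q) := by
      have := congrFun (congrFun (C.lower.lower.lower_nab_grad_comm p a T) c) q
      rw [Pi.add_apply, Pi.add_apply, C.lower.lower_curv, Pi.sub_apply, C.lower_curv,
        Finset.sum_apply] at this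
      exact this
    have e2 : C.lower.lower.lower.nab a H p c q
        = C.lower.lower.lower.nab a H c p q + C.lower.lower.lower.nab a K p c q := by
      conv_lhs => rw [hHK, map_add]
      simp only [Pi.add_apply]
      congr 1
      exact congrFun (C.lower.lower_nab_swap a H p c) q
    rw [e1, e2]
  -- the two Ricci terms cancel
  have h5 : (G.tr fun p q => G.tr fun a c => ∑ r, G.riem p a q r • T c r)
      + (G.tr fun p q => G.tr fun a c => ∑ r, G.riem p a c r • T r q) = 0 := by
    have e1 : (G.tr fun p q => G.tr fun a c => ∑ r, G.riem p a q r • T c r)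
        = - G.tr fun a c => contract (G.mixedRic a) (T c) := by
      rw [tr_tr, ← tr_neg]
      congr 1; funext a c
      simp only [contract, tr_sum, tr_smul_const, mixedRic, neg_smul, Finset.sum_neg_distrib,
        neg_neg]
    have e2 : (G.tr fun p q => G.tr fun a c => ∑ r, G.riem p a c r • T r q)
        = G.tr fun p q => contract (G.mixedRic p) fun r => T r q := by
      congr 1; funext p q
      simp only [contract, tr_sum, tr_smul_const, mixedRic, riem_antisymm p, tr_neg]
    rw [e1, e2, tr_contract_mixedRic hρ, neg_add_cancel]
  have h6 : (G.tr fun p q => G.tr fun a c => C.lower.lower.lower.nab p H a c q)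
      = G.tr fun p q => G.tr fun a c => C.lower.lower.lower.nab a H c p q
        + C.lower.lower.lower.nab a K p c q
        + (C.curv p a (T c q) - ∑ r, G.riem p a q r • T c r - ∑ r, G.riem p a c r • T r q) := by
    simp only [← h4]
  rw [h1, h2, h3, h6]
  simp only [tr_add, tr_sub]
  rw [sub_sub, h5, sub_zero]
  change _ = _ + (G.tr fun p q => G.tr fun a c => C.curv p a (T c q)) + _
  abel

/-- `div P = g^{pq} g^{ac} (∇_a F)_{pc} h_q + g^{pq} g^{ac} F_{pa} ∇_c h_q` for
`P_c = g^{pq} F_{pc} h_q`. -/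
lemma div_tr_curv (C : G.Connection W) (h : ι → W) :
    C.div (fun c => G.tr fun p q => C.curv p c (h q))
      = (G.tr fun p q => G.tr fun a c => C.dcurv a p c (h q))
        + G.tr fun p q => G.tr fun a c => C.curv p a (C.lower.nab c h q) := by
  have h1 : ∀ a c, C.lower.nab a (fun c => G.tr fun p q => C.curv p c (h q)) c
      = G.tr fun p q => C.dcurv a p c (h q) + C.curv p c (C.lower.nab a h q) := by
    intro a c
    rw [lower_nab_tr_last]
    congr 1; funext p q
    simp only [dcurv, lower_nab, Pi.sub_apply, Finset.sum_apply, Pi.smul_apply, map_sub, map_sum,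
      curv_smul]
    abel
  unfold div
  simp only [h1, tr_add]
  rw [tr_tr (fun p q a c => C.dcurv a p c (h q)),
    tr_tr (fun p q a c => C.curv p a (C.lower.nab c h q)),
    ← tr_swap fun a c => G.tr fun p q => C.curv p c (C.lower.nab a h q)]

lemma contract_tr (X : ι → A) (B : ι → ι → ι → W) :
    contract X (fun c => G.tr (B c)) = G.tr fun p q => contract X fun c => B c p q := by
  simp only [contract, tr_sum, tr_smul]

lemma nab_contract (C : G.Connection W) (a : ι) (X : ι → A) (h : ι → W) :
    C.nab a (contract X h)
      = contract X (C.lower.nab a h) + contract (G.scalarConn.upper.nab a X) h := by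
  simp only [contract, map_sum, C.leibniz, lower_nab, upper_nab, scalarConn_nab, smul_sub, add_smul,
    Finset.sum_add_distrib, Finset.sum_sub_distrib, Finset.smul_sum, Finset.sum_smul, smul_eq_mul,
    mul_smul]
  rw [Finset.sum_comm (f := fun x y => X x • G.Γ a x y • h y)]
  simp only [smul_comm (X _)]
  abel

lemma lower_nab_contract (C : G.Connection W) (a b : ι) (X : ι → A) (S : ι → ι → W) :
    C.lower.nab a (fun b => contract X (S b)) b
      = contract X (C.lower.lower.nab a S b) + contract (G.scalarConn.upper.nab a X) (S b) := by
  rw [lower_nab, nab_contract]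
  simp only [contract, lower_nab, Pi.sub_apply, Finset.sum_apply, Pi.smul_apply, smul_sub,
    Finset.sum_sub_distrib, Finset.smul_sum]
  rw [Finset.sum_comm (f := fun x y => G.Γ a b x • X y • S x y)]
  simp only [smul_comm (X _)]
  abel

/-- The heat operator `∇_X h_q - Δh_q + 2 g^{ps} F_{pq} h_s` on `W`-valued 1-forms. If `W` consists
of 1-forms, then `h` is a 2-tensor and the last term is `-2 g^{ps} h_{sr} R_{pqb}^r`, see
`heatOp_apply`. -/
def heatOp (C : G.Connection W) (X : ι → A) (h : ι → W) (q : ι) : W :=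
  contract X (fun c => C.lower.nab c h q) - C.lower.lap h q
    + ((G.tr fun p s => C.curv p q (h s)) + G.tr fun p s => C.curv p q (h s))

lemma div_add (C : G.Connection W) (h h' : ι → W) :
    C.div (fun c => h c + h' c) = C.div h + C.div h' := by
  change C.div (h + h') = _
  simp only [div, map_add, Pi.add_apply, tr_add]

lemma div_sub (C : G.Connection W) (h h' : ι → W) :
    C.div (fun c => h c - h' c) = C.div h - C.div h' := by
  change C.div (h - h') = _
  simp only [div, map_sub, Pi.sub_apply, tr_sub]

/-- Let `∇_a X^c = -ρ_a^c` and `X^c h_c = div h`. Then the divergence of the heat operator `E` of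
`h` is `X^c E_c`, up to the term `g^{pq} (g^{ac} (∇_a F)_{pc} - X^c F_{pc}) h_q`. All Ricci terms
and all contractions of `F` with `∇h` cancel. -/
theorem div_heatOp (C : G.Connection W)
    (hρ : ∀ a c, ∑ b, G.ginv a b * G.mixedRic b c = ∑ b, G.ginv c b * G.mixedRic b a)
    (X : ι → A) (hX : ∀ a c, G.scalarConn.upper.nab a X c = -G.mixedRic a c)
    (h : ι → W) (hdiv : contract X h = C.div h) :
    C.div (C.heatOp X h) = contract X (C.heatOp X h)
      + ((G.tr fun p q => G.tr fun a c => C.dcurv a p c (h q))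
        - contract X fun c => G.tr fun p q => C.curv p c (h q)) := by
  have hX' : ∀ (a : ι) {W' : Type _} [AddCommGroup W'] [Module A W'] (k : ι → W'),
      contract (G.scalarConn.upper.nab a X) k = - contract (G.mixedRic a) k := by
    intro a W' _ _ k
    simp [contract, hX]
  set T : ι → ι → W := C.lower.grad h with hT
  set P : ι → W := fun c => G.tr fun p q => C.curv p c (h q) with hP
  have h3 : C.lap (contract X h) = contract X (C.lower.lap h)
      - (G.tr fun a b => contract (G.mixedRic a) (T b))
      - C.div fun b => contract (G.mixedRic b) h := by
    have e : C.grad (contract X h) = fun b => contract X (T b) - contract (G.mixedRic b) h := by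
      funext b
      rw [grad_apply, nab_contract, hX', ← sub_eq_add_neg]; rfl
    rw [lap, e, div_sub]
    congr 1
    simp only [div, lower_nab_contract, hX', ← sub_eq_add_neg, tr_sub]
    congr 1
    rw [← contract_tr X fun c p q => C.lower.lower.nab p T q c]
    refine congrArg (contract X) (funext fun c => ?_)
    rw [lap, div, tr_apply]
  have h4 : C.div (fun q => contract X fun c => T c q)
      = contract X (fun q => contract X fun c => T c q) + contract X P
        - G.tr fun p q => contract (G.mixedRic p) fun r => T r q := by
    simp only [div]
    have e1 : ∀ p q, C.lower.nab p (fun q => contract X fun c => T c q) q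
        = contract X (fun c => C.lower.lower.nab c T p q)
          + contract X (fun c => C.curv p c (h q) - ∑ r, G.riem p c q r • h r)
          - contract (G.mixedRic p) fun r => T r q := by
      intro p q
      rw [C.lower_nab_contract p q X fun b c => T c b, hX', ← contract_add, sub_eq_add_neg]
      congr 1
      refine congrArg (contract X) (funext fun c => ?_)
      have := congrFun (C.lower.lower_nab_grad_comm p c h) q
      rw [Pi.add_apply, C.lower_curv] at this
      rw [← this]
      exact C.lower_nab_swap p T q c
    have e2 : ∀ c, C.nab c (contract X h) = contract X (T c) - contract (G.mixedRic c) h := by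
      intro c
      rw [nab_contract, hX', ← sub_eq_add_neg]; rfl
    have e3 : ∀ c, C.nab c (contract X h) = G.tr fun p q => C.lower.lower.nab c T p q := fun c => by
      rw [hdiv, div, nab_tr]; rfl
    have e4 : ∀ c, (G.tr fun p q => C.curv p c (h q) - ∑ r, G.riem p c q r • h r)
        = P c + contract (G.mixedRic c) h := fun c => by
      simp only [hP, contract, tr_sub, tr_sum, tr_smul_const, mixedRic, neg_smul,
        Finset.sum_neg_distrib]
      abel
    simp only [e1, tr_sub, tr_add]
    rw [← contract_tr X fun c p q => C.lower.lower.nab c T p q,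
      ← contract_tr X fun c p q => C.curv p c (h q) - ∑ r, G.riem p c q r • h r]
    simp only [← e3, e2, e4, contract_add, contract_sub]
    rw [contract_contract_swap X X T]
    abel
  have h5 : (C.heatOp X h) = fun q => (contract X fun c => T c q) - C.lower.lap h q + (P q + P q)
    := rfl
  rw [h5]
  simp only [div_add, div_sub, contract_add, contract_sub]
  have h6 := C.div_lap hρ h
  rw [div_add, ← hdiv, h3, C.div_tr_curv h] at h6
  rw [h4, h6, C.div_tr_curv h, tr_contract_mixedRic hρ T]
  abel

end Connection
/-! ### Symmetries of the curvature and of its derivative -/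

variable (G) in
/-- Raising an index, `T^m = g^{mk} T_k`. -/
def sharp (T : ι → W) (m : ι) : W := ∑ k, G.ginv m k • T k

lemma Connection.upper_nab_sharp (C : G.Connection W) (a m : ι) (T : ι → W) :
    C.upper.nab a (G.sharp T) m = G.sharp (C.lower.nab a T) m := by
  have h1 : ∀ p q, G.D a (G.ginv p q)
      = - ∑ r, G.Γ a r p * G.ginv r q - ∑ r, G.Γ a r q * G.ginv p r := fun p q => by
    linear_combination G.ginv_parallel a p q
  simp only [sharp, upper_nab, lower_nab, map_sum, C.leibniz, h1, sub_smul, neg_smul,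
    Finset.sum_smul, Finset.smul_sum, Finset.sum_add_distrib, Finset.sum_sub_distrib,
    Finset.sum_neg_distrib, mul_smul, smul_sub]
  rw [Finset.sum_comm (f := fun x y => G.Γ a y m • G.ginv y x • T x),
    Finset.sum_comm (f := fun x y => G.Γ a y x • G.ginv m y • T x)]
  simp only [smul_comm (G.Γ a _ _) (G.ginv m _)]
  abel

lemma Connection.upper_nab_swap (C : G.Connection W) (a : ι) (B : ι → ι → W) (p q : ι) :
    C.upper.upper.nab a (fun p q => B q p) p q = C.upper.upper.nab a B q p := by
  simp only [Connection.upper_nab, Pi.add_apply, Finset.sum_apply, Pi.smul_apply]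
  abel

/-- The curvature is skew in its last two indices once the third one is raised: it acts trivially on
the parallel form `g^{kl}`. No nondegeneracy is needed. -/
lemma riem_skew (a b k l : ι) :
    G.sharp (fun q => G.riem a b q l) k + G.sharp (fun q => G.riem a b q k) l = 0 := by
  have h0 : ∀ c, G.scalarConn.upper.upper.nab c G.ginv = 0 := by
    intro c
    funext a b
    simp only [Connection.upper_nab, Pi.add_apply, Finset.sum_apply, Pi.smul_apply, scalarConn_nab,
      smul_eq_mul, Pi.zero_apply]
    linear_combination G.ginv_parallel c a b
  have h1 : G.scalarConn.upper.upper.curv a b G.ginv k l = 0 := by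
    simp [Connection.curv_apply, h0]
  rw [Connection.upper_curv, Pi.add_apply, Connection.upper_curv, Connection.scalar_curv,
    Finset.sum_apply, zero_add]
    at h1
  rw [← h1, add_comm]
  simp only [sharp, Pi.smul_apply, smul_eq_mul, mul_comm, G.ginv_symm l]
  exact add_comm _ _

variable (G) in
/-- The covariant derivative `∇_a R_{ijk}^l`. -/
def driem (a i j k l : ι) : A := G.scalarConn.upper.lower.lower.lower.nab a G.riem i j k l

lemma driem_eq (a i j k l : ι) : G.driem a i j k l
    = G.D a (G.riem i j k l) - ∑ p, G.Γ a i p * G.riem p j k l - ∑ p, G.Γ a j p * G.riem i p k l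
      - ∑ p, G.Γ a k p * G.riem i j p l + ∑ p, G.Γ a p l * G.riem i j k p := by
  simp only [driem, Connection.upper_nab, Connection.lower_nab, Pi.sub_apply, Finset.sum_apply,
    Pi.smul_apply,
    scalarConn_nab, smul_eq_mul]
  ring

lemma driem_antisymm (a i j k l : ι) : G.driem a i j k l = -G.driem a j i k l := by
  have h : G.riem = -fun i j => G.riem j i := by
    funext i j k l; exact G.riem_antisymm i j k l
  unfold driem
  conv_lhs => rw [h, map_neg]
  exact congrArg Neg.neg (congrFun (congrFun (Connection.lower_nab_swap _ a G.riem i j) k) l)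

/-- The first Bianchi identity, differentiated. -/
lemma driem_cyclic (a i j k l : ι) :
    G.driem a i j k l + G.driem a j k i l + G.driem a k i j l = 0 := by
  have h : ∀ i j k l, G.riem i j k l = - G.riem j k i l - G.riem k i j l := fun i j k l => by
    linear_combination G.riem_cyclic i j k l
  have h1 : G.driem a i j k l = - G.driem a j k i l - G.driem a k i j l := by
    simp only [driem_eq, h i, h _ j k, map_neg, map_sub, mul_sub, mul_neg,
      Finset.sum_neg_distrib, Finset.sum_sub_distrib]
    ring
  rw [h1]; ring

lemma driem_skew (a i j k l : ι) :
    G.sharp (fun q => G.driem a i j q l) k + G.sharp (fun q => G.driem a i j q k) l = 0 := by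
  set V : ι → ι → ι → ι → A := fun k l i j => G.riem i j k l with hV
  have h0 : G.sharp V + (fun l k => G.sharp V k l) = 0 := by
    funext k l i j
    have := G.riem_skew i j k l
    simpa [sharp, hV] using this
  have h1 : ∀ k l, G.scalarConn.lower.lower.upper.upper.nab a (G.sharp V) k l i j
      = G.sharp (fun q => G.driem a i j q l) k := by
    intro k l
    rw [Connection.upper_nab_sharp]
    simp only [sharp, Finset.sum_apply, Pi.smul_apply, smul_eq_mul]
    refine Finset.sum_congr rfl fun q _ => ?_
    congr 1
    rw [driem_eq]
    simp only [Connection.upper_nab, Connection.lower_nab, Pi.sub_apply, Pi.add_apply,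
      Finset.sum_apply,
      Pi.smul_apply, scalarConn_nab, smul_eq_mul, hV]
    ring
  have h2 := congrArg (fun V => G.scalarConn.lower.lower.upper.upper.nab a V k l i j) h0
  simp only [map_add, map_zero, Pi.add_apply, Connection.upper_nab_swap, Pi.zero_apply] at h2
  rwa [h1, h1] at h2

lemma lower_scalar_curv (p c b : ι) (w : ι → A) :
    G.scalarConn.lower.curv p c w b = - ∑ r, G.riem p c b r * w r := by
  rw [Connection.lower_curv, Connection.scalar_curv, zero_sub]; rfl

lemma lower_scalar_dcurv (a p c b : ι) (w : ι → A) :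
    G.scalarConn.lower.dcurv a p c w b = - ∑ r, G.driem a p c b r * w r := by
  simp only [Connection.dcurv, Pi.sub_apply, Finset.sum_apply, Pi.smul_apply, lower_scalar_curv,
    Connection.lower_nab, scalarConn_nab, driem_eq, map_neg, map_sum, Derivation.leibniz,
      smul_eq_mul,
    add_mul, sub_mul, mul_sub, Finset.sum_sub_distrib, Finset.sum_add_distrib, Finset.mul_sum,
    Finset.sum_mul, mul_neg, Finset.sum_neg_distrib]
  rw [Finset.sum_comm (f := fun x i => G.Γ a p i * G.riem i c b x * w x),
    Finset.sum_comm (f := fun x i => G.Γ a c i * G.riem p i b x * w x),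
    Finset.sum_comm (f := fun x i => G.Γ a b i * G.riem p c i x * w x),
    Finset.sum_comm (f := fun x i => G.Γ a i x * G.riem p c b i * w x)]
  simp only [mul_assoc, mul_left_comm (G.riem p c b _), mul_comm (w _)]
  ring

/-- The second Bianchi identity for an arbitrary connection: the Jacobi identity for the `∇_a`. -/
lemma Connection.dcurv_cyclic (C : G.Connection W) (a b c : ι) (w : W) :
    C.dcurv a b c w + C.dcurv b c a w + C.dcurv c a b w = 0 := by
  simp only [Connection.dcurv, G.Γ_symm c a, G.Γ_symm c b, G.Γ_symm b a, C.curv_antisymm c _ w, 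
    C.curv_antisymm _ a w, Connection.curv_apply, map_sub, map_neg, smul_sub, smul_neg,
      Finset.sum_neg_distrib, Finset.sum_sub_distrib]
  abel

/-- The second Bianchi identity. -/
lemma driem_bianchi (a b c k l : ι) :
    G.driem a b c k l + G.driem b c a k l + G.driem c a b k l = 0 := by
  classical
  have h := congrFun (G.scalarConn.lower.dcurv_cyclic a b c (Pi.single l 1)) k
  simp only [Pi.add_apply, lower_scalar_dcurv] at h
  simp [Pi.single_apply] at h
  linear_combination -h


lemma scalar_upper_nab_mixedRic (a c k : ι) :
    G.scalarConn.upper.lower.nab a G.mixedRic c k = - G.tr fun p q => G.driem a p c q k := by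
  have h : G.mixedRic = - fun c => G.tr fun p q => G.riem p c q := by
    funext c r
    simp only [Pi.neg_apply, tr_apply, mixedRic]
  rw [h, map_neg, Pi.neg_apply, Connection.lower_nab_tr_mid, Pi.neg_apply, tr_apply]
  rfl

/-- The second Bianchi identity traced with `g^{pq}`. -/
lemma tr_driem_first (c e r : ι) :
    G.tr (fun p q => G.driem p c e q r)
      = G.scalarConn.upper.lower.nab e G.mixedRic c r - G.scalarConn.upper.lower.nab c G.mixedRic e
        r := by
  have h : ∀ p q, G.driem p c e q r = -G.driem e p c q r + G.driem c p e q r := fun p q => by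
    linear_combination G.driem_bianchi p c e q r - G.driem_antisymm c p e q r
  simp only [h, tr_add, tr_neg, scalar_upper_nab_mixedRic]
  ring

/-- If `∇_a X^c = -ρ_a^c`, then `X^b R_{ceb}^r = g^{pq} ∇_p R_{ceq}^r`: the left side is the
commutator of two derivatives of `X`, the right side is the traced second Bianchi identity. -/
lemma contract_riem (X : ι → A) (hX : ∀ a c, G.scalarConn.upper.nab a X c = -G.mixedRic a c)
    (c e r : ι) :
    ∑ b, X b * G.riem c e b r = G.tr fun p q => G.driem p c e q r := by
  have h1 : G.scalarConn.upper.grad X = - G.mixedRic := by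
    funext a c; exact hX a c
  have h2 := congrFun (G.scalarConn.upper.lower_nab_grad_comm c e X) r
  rw [h1, Pi.add_apply, Connection.upper_curv, Connection.scalar_curv, map_neg, map_neg] at h2
  simp only [Pi.neg_apply, smul_eq_mul, zero_add] at h2
  rw [tr_driem_first]
  simp only [mul_comm (X _)]
  linear_combination -h2

variable (G) in
/-- The tensor `Θ_{pb}^r = X^c R_{pcb}^r - g^{ac} ∇_a R_{pcb}^r` that controls the error term of
`Connection.div_heatOp`. -/
def curvDefect (X : ι → A) (p b r : ι) : A :=
  ∑ c, X c * G.riem p c b r - G.tr fun a c => G.driem a p c b r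

/-- `Θ` is symmetric in its lower indices: by the first Bianchi identity the skew part is the
difference of the two sides of `contract_riem`. -/
lemma curvDefect_symm (X : ι → A) (hX : ∀ a c, G.scalarConn.upper.nab a X c = -G.mixedRic a c)
    (p b r : ι) : G.curvDefect X p b r = G.curvDefect X b p r := by
  have h1 : ∑ c, X c * G.riem p c b r - ∑ c, X c * G.riem b c p r
      = ∑ c, X c * G.riem p b c r := by
    rw [← Finset.sum_sub_distrib]
    refine Finset.sum_congr rfl fun c _ => ?_
    linear_combination (X c) * G.riem_cyclic p c b r - X c * G.riem_antisymm c b p r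
      - X c * G.riem_antisymm b p c r
  have h2 : (G.tr fun a c => G.driem a p c b r) - (G.tr fun a c => G.driem a b c p r)
      = G.tr fun a c => G.driem a p b c r := by
    rw [← tr_sub]
    congr 1; funext a c
    linear_combination G.driem_cyclic a p c b r - G.driem_antisymm a c b p r
      - G.driem_antisymm a b p c r
  simp only [curvDefect]
  linear_combination h1 - h2 + contract_riem X hX p b r

lemma curvDefect_skew (X : ι → A) (p k l : ι) :
    G.sharp (fun q => G.curvDefect X p q l) k + G.sharp (fun q => G.curvDefect X p q k) l = 0 := by
  have h : ∀ k l, G.sharp (fun q => G.curvDefect X p q l) k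
      = ∑ c, X c * G.sharp (fun q => G.riem p c q l) k
        - G.tr fun a c => G.sharp (fun q => G.driem a p c q l) k := by
    intro k l
    simp only [sharp, curvDefect, smul_sub, Finset.sum_sub_distrib, tr_sum, tr_smul, Finset.mul_sum,
      Finset.smul_sum]
    rw [Finset.sum_comm]
    simp only [smul_eq_mul, mul_left_comm (G.ginv _ _) (X _)]
  have h2 : (G.tr fun a c => G.sharp (fun q => G.driem a p c q l) k)
      + (G.tr fun a c => G.sharp (fun q => G.driem a p c q k) l) = 0 := by
    rw [← tr_add]
    simp only [driem_skew]
    simp [tr]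
  have h1 : ∑ c, X c * G.sharp (fun q => G.riem p c q l) k
      + ∑ c, X c * G.sharp (fun q => G.riem p c q k) l = 0 := by
    simp only [← Finset.sum_add_distrib, ← mul_add, riem_skew, mul_zero, Finset.sum_const_zero]
  rw [h, h]
  linear_combination h1 - h2

lemma eq_zero_of_add_self {V : Type*} [AddCommGroup V] [Module ℝ V] {a : V} (h : a + a = 0) :
    a = 0 := by
  rw [← two_smul ℝ] at h
  simpa using h

/-- The contraction `g^{pq} Y_p^r h_{qr}` vanishes if `Y` is skew after raising its lower index and
`h` is symmetric. -/
lemma tr_skew_symm (Y : ι → ι → A) (hY : ∀ k l, G.sharp (fun q => Y q l) k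
      + G.sharp (fun q => Y q k) l = 0) (h : ι → ι → A) (hh : ∀ a b, h a b = h b a) :
    (G.tr fun p q => ∑ r, Y p r * h q r) = 0 := by
  have h1 : (G.tr fun p q => ∑ r, Y p r * h q r)
      = ∑ q, ∑ r, G.sharp (fun p => Y p r) q * h q r := by
    rw [← tr_swap]
    simp only [tr, sharp, smul_eq_mul, Finset.sum_mul, Finset.mul_sum, mul_assoc]
    exact Finset.sum_congr rfl fun _ _ => Finset.sum_comm
  apply eq_zero_of_add_self
  rw [h1]
  nth_rw 2 [Finset.sum_comm]
  simp only [← Finset.sum_add_distrib]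
  refine Finset.sum_eq_zero fun q _ => Finset.sum_eq_zero fun r _ => ?_
  rw [hh r q, ← add_mul, hY, zero_mul]

/-- For a symmetric 2-tensor `h` with `X^c h_{cb} = g^{pq} ∇_p h_{qb}`, where `∇_a X^c = -ρ_a^c`,
the heat operator `E` of `h` inherits the property `X^c E_{cb} = g^{pq} ∇_p E_{qb}`. -/
theorem div_heatOp_eq
    (hρ : ∀ a c, ∑ b, G.ginv a b * G.mixedRic b c = ∑ b, G.ginv c b * G.mixedRic b a)
    (X : ι → A) (hX : ∀ a c, G.scalarConn.upper.nab a X c = -G.mixedRic a c)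
    (h : ι → ι → A) (hh : ∀ a b, h a b = h b a) (hdiv : contract X h = G.scalarConn.lower.div h) :
    G.scalarConn.lower.div (G.scalarConn.lower.heatOp X h)
      = contract X (G.scalarConn.lower.heatOp X h) := by
  rw [Connection.div_heatOp _ hρ X hX h hdiv, add_eq_left]
  funext b
  -- the error term is `g^{pq} Θ_{pb}^r h_{qr} = g^{pq} Θ_{bp}^r h_{qr}`
  have h2 := tr_skew_symm (G := G) (fun p r => G.curvDefect X b p r) (curvDefect_skew X b) h hh
  simp only [← curvDefect_symm X hX _ b] at h2
  rw [Pi.zero_apply, ← h2]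
  simp only [contract, Pi.sub_apply, tr_apply, Finset.sum_apply, Pi.smul_apply, lower_scalar_dcurv,
    lower_scalar_curv, curvDefect, sub_mul, Finset.sum_sub_distrib, tr_sub, smul_eq_mul]
  have h3 : (G.tr fun p q => ∑ x, (∑ c, X c * G.riem p c b x) * h q x)
      = ∑ c, X c * G.tr fun p q => ∑ x, G.riem p c b x * h q x := by
    simp only [← smul_eq_mul (a := X _), ← tr_smul, ← tr_sum]
    congr 1; funext p q
    simp only [smul_eq_mul, Finset.sum_mul, Finset.mul_sum, mul_assoc]
    exact Finset.sum_comm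
  have h4 : (G.tr fun p q => ∑ x, (G.tr fun a c => G.driem a p c b x) * h q x)
      = G.tr fun p q => G.tr fun a c => ∑ x, G.driem a p c b x * h q x := by
    simp only [tr_sum, ← smul_eq_mul, tr_smul_const]
  rw [h3, h4]
  simp only [tr_neg, mul_neg, Finset.sum_neg_distrib]
  ring

/-! ### The Ricci tensor and the Levi-Civita connection -/

variable (G) in
/-- The Ricci tensor `R_{jk} = R_{pjk}^p`. -/
def ric (j k : ι) : A := ∑ p, G.riem p j k p

lemma mixedRic_eq_sharp (c r : ι) : G.mixedRic c r = G.sharp (G.ric c) r := by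
  have h1 : G.mixedRic c r = - ∑ p, G.sharp (fun q => G.riem p c q r) p := rfl
  have h2 : ∀ p, G.sharp (fun q => G.riem p c q r) p = - G.sharp (fun q => G.riem p c q p) r :=
    fun p => eq_neg_of_add_eq_zero_left (riem_skew p c p r)
  rw [h1, Finset.sum_congr rfl fun p _ => h2 p]
  simp only [Finset.sum_neg_distrib, neg_neg, sharp, ric, Finset.smul_sum]
  exact Finset.sum_comm

/-- The Ricci tensor of a torsion-free connection is symmetric if the traces `R_{abp}^p` vanish. -/
lemma ric_symm (htr : ∀ a b, ∑ p, G.riem a b p p = 0) (j k : ι) : G.ric j k = G.ric k j := by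
  have h : ∑ p, (G.riem p j k p + G.riem j k p p + G.riem k p j p) = 0 :=
    Finset.sum_eq_zero fun p _ => G.riem_cyclic p j k p
  simp only [Finset.sum_add_distrib, htr, riem_antisymm k _ j, Finset.sum_neg_distrib] at h
  simp only [ric]
  linear_combination h

lemma sharp_mixedRic_symm (htr : ∀ a b, ∑ p, G.riem a b p p = 0) (a c : ι) :
    ∑ b, G.ginv a b * G.mixedRic b c = ∑ b, G.ginv c b * G.mixedRic b a := by
  simp only [mixedRic_eq_sharp, sharp, smul_eq_mul, Finset.mul_sum]
  rw [Finset.sum_comm]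
  refine Finset.sum_congr rfl fun x _ => Finset.sum_congr rfl fun y _ => ?_
  rw [ric_symm htr x y]; ring

/-- An endomorphism that is skew with respect to a nondegenerate symmetric form is trace-free. -/
lemma trace_eq_zero_of_skew {κ : Type*} [Fintype κ] [DecidableEq κ] (γ : Matrix κ κ A)
    (hγ : IsUnit γ.det) (hsymm : γ.IsSymm) (M : κ → κ → A)
    (hM : ∀ k l, ∑ q, γ⁻¹ k q * M q l + ∑ q, γ⁻¹ l q * M q k = 0) : ∑ p, M p p = 0 := by
  have h1 : ∑ p, M p p = ∑ k, ∑ q, γ k q * ∑ r, γ⁻¹ q r * M r k := by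
    have : (Matrix.of M).trace = (γ * (γ⁻¹ * Matrix.of M)).trace := by
      rw [Matrix.mul_nonsing_inv_cancel_left _ _ hγ]
    simpa [Matrix.trace, Matrix.mul_apply] using this
  apply eq_zero_of_add_self
  rw [h1]
  nth_rw 2 [Finset.sum_comm]
  simp only [← Finset.sum_add_distrib]
  refine Finset.sum_eq_zero fun q _ => Finset.sum_eq_zero fun r _ => ?_
  rw [hsymm.apply q r, ← mul_add, hM, mul_zero]

lemma sum_driem (p c q : ι) :
    ∑ e, G.driem p e c q e = G.scalarConn.lower.lower.nab p G.ric c q := by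
  simp only [driem_eq, Connection.lower_nab, Pi.sub_apply, Finset.sum_apply, Pi.smul_apply,
    scalarConn_nab, smul_eq_mul, ric, Finset.sum_add_distrib, Finset.sum_sub_distrib, map_sum,
    Finset.mul_sum]
  rw [Finset.sum_comm (f := fun x y => G.Γ p x y * G.riem y c q x),
    Finset.sum_comm (f := fun x y => G.Γ p c y * G.riem x y q x),
    Finset.sum_comm (f := fun x y => G.Γ p q y * G.riem x c y x)]
  ring

lemma nab_mixedRic (a c k : ι) : G.scalarConn.upper.lower.nab a G.mixedRic c k
    = G.sharp (G.scalarConn.lower.lower.nab a G.ric c) k := by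
  have h : G.mixedRic = fun c => G.sharp (G.ric c) := by funext c r; exact mixedRic_eq_sharp c r
  rw [h, Connection.lower_nab, Pi.sub_apply, Connection.upper_nab_sharp, Connection.lower_nab]
  simp only [sharp, Finset.sum_apply, Pi.smul_apply, Pi.sub_apply, smul_eq_mul, mul_sub,
    Finset.sum_sub_distrib, Finset.mul_sum]
  rw [Finset.sum_comm]
  simp only [mul_left_comm]

lemma sum_nab_mixedRic (a : ι) :
    ∑ e, G.scalarConn.upper.lower.nab a G.mixedRic e e = G.D a (∑ e, G.mixedRic e e) := by
  simp only [Connection.lower_nab, Connection.upper_nab, Pi.sub_apply, Finset.sum_apply,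
    Pi.smul_apply,
    scalarConn_nab, smul_eq_mul, Finset.sum_add_distrib, Finset.sum_sub_distrib, map_sum]
  rw [Finset.sum_comm (f := fun x y => G.Γ a x y * G.mixedRic y x)]
  ring

/-- The contracted second Bianchi identity `2 ∇_e R_c^e = ∂_c R`. -/
lemma two_mul_div_mixedRic (c : ι) :
    2 * ∑ e, G.scalarConn.upper.lower.nab e G.mixedRic c e = G.D c (∑ e, G.mixedRic e e) := by
  have h1 : ∑ e, G.tr (fun p q => G.driem p c e q e)
      = ∑ e, G.scalarConn.upper.lower.nab e G.mixedRic c e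
        - ∑ e, G.scalarConn.upper.lower.nab c G.mixedRic e e := by
    rw [← Finset.sum_sub_distrib]
    exact Finset.sum_congr rfl fun e _ => tr_driem_first c e e
  have h2 : ∑ e, G.tr (fun p q => G.driem p c e q e)
      = - ∑ e, G.scalarConn.upper.lower.nab e G.mixedRic c e := by
    rw [← tr_sum]
    simp only [driem_antisymm _ c, Finset.sum_neg_distrib, sum_driem, tr_neg, nab_mixedRic]
    rfl
  rw [sum_nab_mixedRic] at h1
  linear_combination h2 - h1

/-- If a derivation satisfies `D γ = N γ + γ Nᵀ`, that is if `γ` is parallel for the connection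
matrix `N`, then so is `γ⁻¹`. -/
lemma derivation_inv_parallel {κ : Type*} [Fintype κ] [DecidableEq κ] (D : Derivation ℝ A A)
    (γ N : Matrix κ κ A) (hγ : IsUnit γ.det) (hD : γ.map D = N * γ + γ * N.transpose) :
    (γ⁻¹).map D + N.transpose * γ⁻¹ + γ⁻¹ * N = 0 := by
  have h1 : (γ⁻¹).map D * γ + γ⁻¹ * γ.map D = 0 := by
    have : (γ⁻¹ * γ).map D = 0 := by
      rw [Matrix.nonsing_inv_mul _ hγ]
      ext i j
      by_cases h : i = j <;> simp [h]
    rw [← this]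
    ext i j
    simp [Matrix.mul_apply, Finset.sum_add_distrib, mul_comm]
  have h2 : (γ⁻¹).map D * γ * γ⁻¹ = (γ⁻¹).map D := Matrix.mul_nonsing_inv_cancel_right _ _ hγ
  have h3 : (γ⁻¹).map D * γ = - (γ⁻¹ * (N * γ + γ * N.transpose)) := by
    rw [← hD]; exact eq_neg_of_add_eq_zero_left h1
  rw [← h2, h3]
  simp only [mul_add, neg_mul, add_mul, ← mul_assoc, Matrix.nonsing_inv_mul _ hγ, one_mul]
  rw [mul_assoc (γ⁻¹ * N), Matrix.mul_nonsing_inv _ hγ]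
  simp only [mul_one]
  abel

section LeviCivita

variable [DecidableEq ι]

/-- The Christoffel symbols `Γ_{ij}^k` of the metric `γ`. -/
def christoffelSymbol (D : ι → Derivation ℝ A A) (γ : Matrix ι ι A) (i j k : ι) : A :=
  (1 / 2 : ℝ) • ∑ l, γ⁻¹ k l * (D i (γ j l) + D j (γ i l) - D l (γ i j))

/-- The geometry of a nondegenerate metric `γ` with its Levi-Civita connection. -/
def leviCivita (D : ι → Derivation ℝ A A) (D_comm : ∀ a b f, D a (D b f) = D b (D a f))
    (γ : Matrix ι ι A) (hγ : IsUnit γ.det) (hsymm : γ.IsSymm) : FrameGeometry ι A where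
  D := D
  D_comm := D_comm
  Γ := christoffelSymbol D γ
  Γ_symm a b c := by
    simp only [christoffelSymbol, hsymm.apply a b, add_comm (D a _)]
  ginv a b := γ⁻¹ a b
  ginv_symm a b := hsymm.inv.apply b a
  ginv_parallel c a b := by
    set N : Matrix ι ι A := Matrix.of fun i k => christoffelSymbol D γ c i k with hN
    have hNγ : ∀ i j, (N * γ) i j = (1 / 2 : ℝ) • (D c (γ i j) + D i (γ c j) - D j (γ c i)) := by
      intro i j
      set v : ι → A := fun l => D c (γ i l) + D i (γ c l) - D l (γ c i)
      have : (γ.mulVec (γ⁻¹.mulVec v)) j = v j := by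
        rw [Matrix.mulVec_mulVec, Matrix.mul_nonsing_inv _ hγ, Matrix.one_mulVec]
      change _ = (1 / 2 : ℝ) • v j
      rw [← this]
      simp only [Matrix.mul_apply, hN, Matrix.of_apply, christoffelSymbol, Matrix.mulVec,
        dotProduct,
        Finset.smul_sum, hsymm.apply j]
      refine Finset.sum_congr rfl fun k _ => ?_
      rw [← Finset.smul_sum, mul_comm, mul_smul_comm]
    have hD : γ.map (D c) = N * γ + γ * N.transpose := by
      have : γ * N.transpose = (N * γ).transpose := by rw [Matrix.transpose_mul, hsymm.eq]
      rw [this]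
      ext i j
      rw [Matrix.add_apply, Matrix.transpose_apply, hNγ, hNγ, hsymm.apply i j, Matrix.map_apply,
        ← smul_add, eq_comm, one_div, inv_smul_eq_iff₀ two_ne_zero, two_smul]
      ring
    have := congrFun (congrFun (derivation_inv_parallel (D c) γ N hγ hD) a) b
    simp only [Matrix.add_apply, Matrix.map_apply, Matrix.mul_apply, Matrix.transpose_apply, hN,
      Matrix.of_apply, Matrix.zero_apply] at this
    simpa only [mul_comm (γ⁻¹ a _)] using this

end LeviCivita

/-! ### Space-time -/

section SpaceTime

variable {A : Type*} [CommRing A] [Algebra ℝ A] {n : ℕ}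

/-- An evolution of the geometry `G` by Ricci flow: a time derivative `D0` that commutes with the
spatial ones and satisfies `∂_t g^{ab} = 2 R^{ab}`. The field `trace_of_skew` is what is needed of
the nondegeneracy of `g`. -/
structure TimeEvolution (G : FrameGeometry (Fin n) A) where
  D0 : Derivation ℝ A A
  D0_comm : ∀ a f, D0 (G.D a f) = G.D a (D0 f)
  D0_ginv : ∀ a b, D0 (G.ginv a b)
    = ∑ p, G.mixedRic p a * G.ginv p b + ∑ p, G.mixedRic p b * G.ginv a p
  trace_of_skew : ∀ M : Fin n → Fin n → A,
    (∀ k l, G.sharp (fun q => M q l) k + G.sharp (fun q => M q k) l = 0) → ∑ p, M p p = 0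

variable {G : FrameGeometry (Fin n) A} (F : G.TimeEvolution)

variable (G) in
/-- The scalar curvature. -/
def scalarCurv : A := ∑ e, G.mixedRic e e

namespace TimeEvolution

/-- The coefficients of the space-time connection, as in `spaceTimeConnection`. -/
def coeff (_ : G.TimeEvolution) (a b c : Fin (n + 1)) : A :=
  Fin.cases 0
    (fun k =>
      Fin.cases
        (Fin.cases (-((1 / 2 : ℝ) • G.sharp (fun p => G.D p G.scalarCurv) k))
          (fun j => -G.mixedRic j k) b)
        (fun i => Fin.cases (-G.mixedRic i k) (fun j => G.Γ i j k) b) a) c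

/-- The degenerate space-time form on covectors, as in `degenerateMetric`. -/
def cometric (_ : G.TimeEvolution) (a b : Fin (n + 1)) : A :=
  Fin.cases 0 (fun i => Fin.cases 0 (fun j => G.ginv i j) b) a

@[simp] lemma coeff_zero (a b : Fin (n + 1)) : F.coeff a b 0 = 0 := rfl
@[simp] lemma coeff_zero_zero (k : Fin n) :
    F.coeff 0 0 k.succ = -((1 / 2 : ℝ) • G.sharp (fun p => G.D p G.scalarCurv) k) := rfl
@[simp] lemma coeff_zero_succ (j k : Fin n) : F.coeff 0 j.succ k.succ = -G.mixedRic j k := rfl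
@[simp] lemma coeff_succ_zero (i k : Fin n) : F.coeff i.succ 0 k.succ = -G.mixedRic i k := rfl
@[simp] lemma coeff_succ_succ (i j k : Fin n) : F.coeff i.succ j.succ k.succ = G.Γ i j k := rfl
@[simp] lemma cometric_zero_left (b : Fin (n + 1)) : F.cometric 0 b = 0 := rfl
@[simp] lemma cometric_zero_right (b : Fin (n + 1)) : F.cometric b 0 = 0 := by
  cases b using Fin.cases <;> rfl
@[simp] lemma cometric_succ (i j : Fin n) : F.cometric i.succ j.succ = G.ginv i j := rfl

/-- The space-time geometry. That the degenerate form is parallel in the time direction is the Ricci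
flow equation. -/
def extend : FrameGeometry (Fin (n + 1)) A where
  D := Fin.cases F.D0 G.D
  D_comm a b f := by
    cases a using Fin.cases <;> cases b using Fin.cases <;> simp [F.D0_comm, G.D_comm]
  Γ := F.coeff
  Γ_symm a b c := by
    cases a using Fin.cases <;> cases b using Fin.cases <;> cases c using Fin.cases <;>
      simp [G.Γ_symm]
  ginv := F.cometric
  ginv_symm a b := by
    cases a using Fin.cases <;> cases b using Fin.cases <;> simp
    exact G.ginv_symm _ _
  ginv_parallel c a b := by
    cases a using Fin.cases <;> cases b using Fin.cases <;> cases c using Fin.cases <;>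
      simp [Fin.sum_univ_succ, F.D0_ginv]
    exact G.ginv_parallel _ _ _

@[simp] lemma extend_D_zero : F.extend.D 0 = F.D0 := rfl
@[simp] lemma extend_D_succ (i : Fin n) : F.extend.D i.succ = G.D i := rfl
@[simp] lemma extend_Γ : F.extend.Γ = F.coeff := rfl
@[simp] lemma extend_ginv : F.extend.ginv = F.cometric := rfl

variable {W : Type*} [AddCommGroup W] [Module A W]

lemma extend_tr (B : Fin (n + 1) → Fin (n + 1) → W) :
    F.extend.tr B = G.tr fun p q => B p.succ q.succ := by
  simp [tr, Fin.sum_univ_succ]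

lemma extend_sharp_zero (T : Fin (n + 1) → W) : F.extend.sharp T 0 = 0 := by
  simp [sharp]

lemma extend_sharp_succ (T : Fin (n + 1) → W) (k : Fin n) :
    F.extend.sharp T k.succ = G.sharp (fun q => T q.succ) k := by
  simp [sharp, Fin.sum_univ_succ]

lemma extend_riem_zero (a b c : Fin (n + 1)) : F.extend.riem a b c 0 = 0 := by
  simp [riem]

lemma extend_riem_succ (i j k l : Fin n) :
    F.extend.riem i.succ j.succ k.succ l.succ = G.riem i j k l := by
  simp [riem, Fin.sum_univ_succ]

lemma extend_riem_succ_zero (p q r : Fin n) :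
    F.extend.riem p.succ q.succ 0 r.succ = G.scalarConn.upper.lower.nab q G.mixedRic p r
      - G.scalarConn.upper.lower.nab p G.mixedRic q r := by
  simp [riem, Fin.sum_univ_succ, Connection.lower_nab, Connection.upper_nab, G.Γ_symm q p, mul_comm
    (G.Γ _ _ r)]
  ring

lemma extend_trace_riem (a b : Fin (n + 1)) : ∑ p, F.extend.riem a b p p = 0 := by
  rw [Fin.sum_univ_succ, extend_riem_zero, zero_add]
  refine F.trace_of_skew (fun p q => F.extend.riem a b p.succ q.succ) fun k l => ?_
  simpa only [extend_sharp_succ] using F.extend.riem_skew a b k.succ l.succ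

lemma extend_ric_succ_succ (j k : Fin n) : F.extend.ric j.succ k.succ = G.ric j k := by
  rw [ric, Fin.sum_univ_succ, extend_riem_zero, zero_add]
  simp only [extend_riem_succ, ric]

/-- `R̃_{j0} = ½ ∂_j R`, by the contracted second Bianchi identity. -/
lemma extend_ric_succ_zero (j : Fin n) :
    F.extend.ric j.succ 0 = (1 / 2 : ℝ) • G.D j G.scalarCurv := by
  rw [ric, Fin.sum_univ_succ, extend_riem_zero, zero_add]
  simp only [extend_riem_succ_zero, Finset.sum_sub_distrib, sum_nab_mixedRic]
  have h := G.two_mul_div_mixedRic j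
  change _ = G.D j G.scalarCurv at h
  change G.D j G.scalarCurv - _ = _
  rw [← h, eq_comm, one_div, inv_smul_eq_iff₀ two_ne_zero, two_smul]
  ring

/-- `Γ̃_{a0}^c = -R̃_a^c` for all space-time indices `a`, `c`. -/
lemma extend_Γ_zero (a c : Fin (n + 1)) : F.coeff a 0 c = - F.extend.mixedRic a c := by
  rw [mixedRic_eq_sharp]
  cases c using Fin.cases with
  | zero => rw [extend_sharp_zero]; simp
  | succ k =>
    rw [extend_sharp_succ]
    cases a using Fin.cases with
    | zero =>
      simp only [ric_symm F.extend_trace_riem 0, extend_ric_succ_zero, coeff_zero_zero, sharp,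
        Finset.smul_sum, smul_eq_mul, mul_smul_comm]
    | succ i => simp only [extend_ric_succ_succ, coeff_succ_zero, mixedRic_eq_sharp]

/-- The coordinate vector field `∂_t`. -/
def timeField (_ : G.TimeEvolution) : Fin (n + 1) → A := Fin.cases 1 fun _ => 0

lemma contract_timeField (h : Fin (n + 1) → W) : contract F.timeField h = h 0 := by
  simp [contract, timeField, Fin.sum_univ_succ]

/-- The soliton-type equation `∇̃_a X^c = -R̃_a^c` for `X = ∂_t`. -/
lemma nab_timeField (a c : Fin (n + 1)) :
    F.extend.scalarConn.upper.nab a F.timeField c = - F.extend.mixedRic a c := by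
  have h : F.extend.D a (F.timeField c) = 0 := by
    cases c using Fin.cases <;> simp [timeField]
  rw [Connection.upper_nab, scalarConn_nab, h, ← extend_Γ_zero, Fin.sum_univ_succ]
  simp [timeField]

/-- The space-time extension of the 2-tensor `h`, as in `extension`. -/
def extTensor (_ : G.TimeEvolution) (h : Fin n → Fin n → A) (a b : Fin (n + 1)) : A :=
  Fin.cases
    (Fin.cases
      (G.scalarConn.div (G.scalarConn.lower.div h)
        + G.tr fun p q => contract (G.mixedRic p) (h q))
      (fun j => G.scalarConn.lower.div h j) b)
    (fun i => Fin.cases (G.scalarConn.lower.div h i) (fun j => h i j) b) a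

variable (h : Fin n → Fin n → A)

@[simp] lemma extTensor_succ_succ (i j : Fin n) : F.extTensor h i.succ j.succ = h i j := rfl
@[simp] lemma extTensor_succ_zero (i : Fin n) :
    F.extTensor h i.succ 0 = G.scalarConn.lower.div h i := rfl
@[simp] lemma extTensor_zero_succ (i : Fin n) :
    F.extTensor h 0 i.succ = G.scalarConn.lower.div h i := rfl
@[simp] lemma extTensor_zero_zero :
    F.extTensor h 0 0 = G.scalarConn.div (G.scalarConn.lower.div h)
      + G.tr fun p q => contract (G.mixedRic p) (h q) := rfl

lemma extTensor_symm (hh : ∀ i j, h i j = h j i) (a b : Fin (n + 1)) :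
    F.extTensor h a b = F.extTensor h b a := by
  cases a using Fin.cases <;> cases b using Fin.cases <;> simp [hh]

/-- The extension satisfies `h̃_{0b} = g̃^{pq} ∇̃_p h̃_{qb}` for all space-time indices `b`. -/
lemma contract_extTensor :
    contract F.timeField (F.extTensor h) = F.extend.scalarConn.lower.div (F.extTensor h) := by
  rw [contract_timeField]
  funext b
  rw [Connection.div, extend_tr, tr_apply]
  cases b using Fin.cases with
  | zero =>
    rw [extTensor_zero_zero, Connection.div, ← tr_add]
    congr 1; funext p q
    simp [Connection.lower_nab, Fin.sum_univ_succ, contract]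
    ring
  | succ j =>
    rw [extTensor_zero_succ, Connection.div, tr_apply]
    congr 1; funext p q
    simp [Connection.lower_nab, Fin.sum_univ_succ]

end TimeEvolution

variable {ι : Type*} [Fintype ι]

/-- The curvature term `g^{pr} S_{rq} R_{pij}^q`. -/
def curvTerm (G : FrameGeometry ι A) (S : ι → ι → A) (i j : ι) : A :=
  ∑ p, ∑ r, ∑ q, G.ginv p r * S r q * G.riem p i j q

lemma tr_curv_eq (G : FrameGeometry ι A) (S : ι → ι → A) (i j : ι) :
    (G.tr fun p s => G.scalarConn.lower.curv p i (S s)) j = - G.curvTerm S i j := by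
  rw [tr_apply]
  simp only [lower_scalar_curv, tr_neg]
  simp only [tr, curvTerm, smul_eq_mul, Finset.mul_sum, mul_assoc,
    mul_comm (S _ _)]

lemma heatOp_apply (G : FrameGeometry ι A) (X : ι → A) (S : ι → ι → A) (i j : ι) :
    G.scalarConn.lower.heatOp X S i j
      = contract X (fun c => G.scalarConn.lower.lower.nab c S i j)
        - G.scalarConn.lower.lower.lap S i j - 2 * G.curvTerm S i j := by
  simp only [Connection.heatOp, Pi.add_apply, Pi.sub_apply, tr_curv_eq]
  simp only [contract, Finset.sum_apply, Pi.smul_apply]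
  ring

/-- By the first Bianchi identity the skew part of the curvature term is a contraction of `S` with
the skew endomorphisms `R_{ji}`. -/
lemma curvTerm_symm (G : FrameGeometry ι A) (S : ι → ι → A) (hS : ∀ i j, S i j = S j i) (i j : ι) :
    G.curvTerm S i j = G.curvTerm S j i := by
  have h1 : ∀ i j, G.curvTerm S i j = G.tr fun p s => ∑ q, G.riem p i j q * S s q := by
    intro i j
    simp only [tr, curvTerm, smul_eq_mul, Finset.mul_sum, mul_assoc, mul_comm (S _ _)]
  have h2 := tr_skew_symm (G := G) (fun p q => G.riem j i p q) (fun k l => G.riem_skew j i k l) S hS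
  rw [← sub_eq_zero, h1, h1, ← tr_sub, ← h2]
  congr 1; funext p s
  rw [← Finset.sum_sub_distrib]
  refine Finset.sum_congr rfl fun q _ => ?_
  linear_combination S s q * G.riem_cyclic p i j q - S s q * G.riem_antisymm j p i q
    - S s q * G.riem_antisymm j i p q

lemma heatOp_symm (G : FrameGeometry ι A) (X : ι → A) (S : ι → ι → A) (hS : ∀ i j, S i j = S j i)
    (i j : ι) : G.scalarConn.lower.heatOp X S i j = G.scalarConn.lower.heatOp X S j i := by
  have hS' : S = fun i j => S j i := by funext i j; exact hS i j
  have h1 : ∀ c i j, G.scalarConn.lower.lower.nab c S i j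
      = G.scalarConn.lower.lower.nab c S j i := fun c i j => by
    conv_lhs => rw [hS']
    exact Connection.lower_nab_swap _ c S i j
  have h2 : ∀ i j, G.scalarConn.lower.lower.lap S i j = G.scalarConn.lower.lower.lap S j i := by
    intro i j
    simp only [Connection.lap, Connection.div, tr_apply]
    congr 1; funext p q
    simp only [Connection.lower_nab _ p, Connection.grad_apply, Pi.sub_apply, Finset.sum_apply,
      Pi.smul_apply,
      scalarConn_nab, h1 _ i j]
    simp only [h1 _ _ i, h1 _ j _]
    abel
  simp only [heatOp_apply, h1 _ i j, h2 i j, curvTerm_symm G S hS i j]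

section RicciFlow

variable {D : Fin n → Derivation ℝ A A} {D_comm : ∀ a b f, D a (D b f) = D b (D a f)}
  {γ : Matrix (Fin n) (Fin n) A} {hγ : IsUnit γ.det} {hsymm : γ.IsSymm}

lemma leviCivita_trace_riem (a b : Fin n) :
    ∑ p, (leviCivita D D_comm γ hγ hsymm).riem a b p p = 0 :=
  trace_eq_zero_of_skew γ hγ hsymm _ fun k l =>
    riem_skew (G := leviCivita D D_comm γ hγ hsymm) a b k l

lemma leviCivita_ginv_flow (D0 : Derivation ℝ A A)
    (hflow : ∀ i j, D0 (γ i j) = (-2 : ℝ) • (leviCivita D D_comm γ hγ hsymm).ric i j)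
    (a b : Fin n) :
    D0 ((leviCivita D D_comm γ hγ hsymm).ginv a b)
      = ∑ p, (leviCivita D D_comm γ hγ hsymm).mixedRic p a
          * (leviCivita D D_comm γ hγ hsymm).ginv p b
        + ∑ p, (leviCivita D D_comm γ hγ hsymm).mixedRic p b
          * (leviCivita D D_comm γ hγ hsymm).ginv a p := by
  set G := leviCivita D D_comm γ hγ hsymm with hG
  set Rc : Matrix (Fin n) (Fin n) A := Matrix.of G.ric with hRc
  have hRc' : Rc.transpose = Rc := by
    ext i j : 1; exact ric_symm leviCivita_trace_riem j i
  have hN : γ.map D0 = -(Rc * γ⁻¹) * γ + γ * (-(Rc * γ⁻¹)).transpose := by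
    rw [Matrix.transpose_neg, Matrix.transpose_mul, hsymm.inv.eq, hRc', Matrix.neg_mul,
      Matrix.mul_neg, Matrix.nonsing_inv_mul_cancel_right _ _ hγ,
      Matrix.mul_nonsing_inv_cancel_left _ _ hγ]
    ext i j : 1
    change D0 (γ i j) = -G.ric i j + -G.ric i j
    rw [hflow, neg_smul, two_smul]
    ring
  have hrho : Rc * γ⁻¹ = Matrix.of G.mixedRic := by
    ext p c : 1
    rw [Matrix.of_apply, mixedRic_eq_sharp, Matrix.mul_apply]
    exact Finset.sum_congr rfl fun q _ => by rw [mul_comm, ← hsymm.inv.apply q c]; rfl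
  rw [hrho] at hN
  have h := congrFun (congrFun (derivation_inv_parallel D0 _ _ hγ hN) a) b
  simp only [Matrix.add_apply, Matrix.map_apply, Matrix.mul_apply, Matrix.transpose_apply,
    Matrix.neg_apply, Matrix.of_apply, Matrix.zero_apply, neg_mul, mul_neg,
    Finset.sum_neg_distrib] at h
  simp only [mul_comm (G.mixedRic _ b)]
  change D0 (γ⁻¹ a b) = ∑ p, G.mixedRic p a * γ⁻¹ p b + ∑ p, γ⁻¹ a p * G.mixedRic p b
  linear_combination h

/-- The evolution given by a solution of `∂_t γ_{ij} = -2 R_{ij}`. -/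
def TimeEvolution.ofRicciFlow (D0 : Derivation ℝ A A) (D0_comm : ∀ a f, D0 (D a f) = D a (D0 f))
    (hflow : ∀ i j, D0 (γ i j) = (-2 : ℝ) • (leviCivita D D_comm γ hγ hsymm).ric i j) :
    (leviCivita D D_comm γ hγ hsymm).TimeEvolution where
  D0 := D0
  D0_comm := D0_comm
  D0_ginv := leviCivita_ginv_flow D0 hflow
  trace_of_skew M hM := trace_eq_zero_of_skew γ hγ hsymm M hM

end RicciFlow

namespace TimeEvolution
variable {G : FrameGeometry (Fin n) A} (F : G.TimeEvolution) (h : Fin n → Fin n → A)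

lemma extend_nab_succ (c i j : Fin n) :
    F.extend.scalarConn.lower.lower.nab c.succ (F.extTensor h) i.succ j.succ
      = G.scalarConn.lower.lower.nab c h i j := by
  simp [Connection.lower_nab, Fin.sum_univ_succ]

lemma extend_curvTerm_succ (i j : Fin n) :
    F.extend.curvTerm (F.extTensor h) i.succ j.succ = G.curvTerm h i j := by
  simp [curvTerm, Fin.sum_univ_succ, extend_riem_zero, extend_riem_succ]

lemma extend_lap_succ (i j : Fin n) :
    F.extend.scalarConn.lower.lower.lap (F.extTensor h) i.succ j.succ
      = G.scalarConn.lower.lower.lap h i j := by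
  simp only [Connection.lap, Connection.div, tr_apply, extend_tr]
  congr 1; funext p q
  rw [Connection.lower_nab _ p, Connection.lower_nab _ p.succ]
  have h2 : ∀ (C : F.extend.Connection A) (p : Fin (n + 1)) (S : Fin (n + 1) → Fin (n + 1) → A)
    (i j : Fin (n + 1)), C.lower.lower.nab p S i j = C.nab p (S i j)
      - (∑ s, F.coeff p j s * S i s) - ∑ s, F.coeff p i s * S s j := by
    intro C p S i j
    simp [Connection.lower_nab]
  have h3 : ∀ (C : G.Connection A) (p : Fin n) (S : Fin n → Fin n → A)
    (i j : Fin n), C.lower.lower.nab p S i j = C.nab p (S i j)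
      - (∑ s, G.Γ p j s * S i s) - ∑ s, G.Γ p i s * S s j := by
    intro C p S i j
    simp [Connection.lower_nab]
  simp only [Connection.grad_apply, Pi.sub_apply, Pi.add_apply, Finset.sum_apply, Pi.smul_apply,
    smul_eq_mul,
    Fin.sum_univ_succ, extend_Γ, coeff_zero, coeff_succ_succ, zero_mul, zero_add, extend_nab_succ,
    h2 _ p.succ, h3 _ p, scalarConn_nab, extend_D_succ]

/-- The extension of a symmetric solution of the Lichnerowicz heat equation is annihilated by the
space-time heat operator `E`. On spatial indices this is the equation itself. Since
`E_{0b} = g̃^{pq} ∇̃_p E_{qb}`, the components `E_{0j}`, and then `E_{00}`, vanish as well. -/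
theorem heatOp_extTensor (hh : ∀ i j, h i j = h j i)
    (hflow : ∀ i j, F.D0 (h i j) = G.scalarConn.lower.lower.lap h i j + 2 * G.curvTerm h i j
      - ∑ p, G.mixedRic i p * h j p - ∑ p, G.mixedRic j p * h i p) (i j : Fin (n + 1)) :
    F.extend.scalarConn.lower.heatOp F.timeField (F.extTensor h) i j = 0 := by
  set E := F.extend.scalarConn.lower.heatOp F.timeField (F.extTensor h) with hE
  have hsymm : ∀ a b, F.extTensor h a b = F.extTensor h b a := F.extTensor_symm h hh
  have hEsymm : ∀ i j, E i j = E j i := heatOp_symm _ _ _ hsymm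
  have hEss : ∀ i j : Fin n, E i.succ j.succ = 0 := by
    intro i j
    rw [hE, heatOp_apply, contract_timeField, extend_lap_succ, extend_curvTerm_succ]
    simp [Connection.lower_nab, Fin.sum_univ_succ, hflow]
    simp only [hh _ j]
    ring
  have hdiv : F.extend.scalarConn.lower.div E = E 0 := by
    rw [hE, div_heatOp_eq (sharp_mixedRic_symm F.extend_trace_riem) _ F.nab_timeField _ hsymm
      (F.contract_extTensor h), contract_timeField]
  have hE0s : ∀ j : Fin n, E 0 j.succ = 0 := by
    intro j
    rw [← hdiv, Connection.div, tr_apply, extend_tr]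
    simp [Connection.lower_nab, Fin.sum_univ_succ, hEss, tr]
  have hE00 : E 0 0 = 0 := by
    rw [← hdiv, Connection.div, tr_apply, extend_tr]
    simp [Connection.lower_nab, Fin.sum_univ_succ, hEss, hEsymm _ 0, hE0s, tr]
  cases i using Fin.cases with
  | zero => cases j using Fin.cases with
    | zero => exact hE00
    | succ j => exact hE0s j
  | succ i => cases j using Fin.cases with
    | zero => rw [hEsymm]; exact hE0s i
    | succ j => exact hEss i j

end TimeEvolution

end SpaceTime

end FrameGeometry

/-! ### Smooth functions on `[0, T) × U` -/

section SmoothFunctions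

variable {n : ℕ} (T : ℝ) (U : Set (E n))

/-- The ring of smooth functions on `[0, T) × U`, up to the initial time. They are functions on the
subtype, because the values of functions `ℝ × E n → ℝ` off `[0, T) × U` carry no meaning. -/
def smoothFunctions : Subalgebra ℝ (↥(Ico 0 T ×ˢ U) → ℝ) where
  carrier := {f | ∃ F : ℝ × E n → ℝ, ContDiffOn ℝ ∞ F (Ico 0 T ×ˢ U) ∧
    ∀ z : ↥(Ico 0 T ×ˢ U), F z = f z}
  mul_mem' := by
    rintro f f' ⟨F, hF, h⟩ ⟨F', hF', h'⟩
    exact ⟨_, hF.mul hF', fun z => by simp [h, h']⟩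
  add_mem' := by
    rintro f f' ⟨F, hF, h⟩ ⟨F', hF', h'⟩
    exact ⟨_, hF.add hF', fun z => by simp [h, h']⟩
  algebraMap_mem' c := ⟨fun _ => c, contDiffOn_const, fun z => rfl⟩

variable {T U}

/-- The smooth function `f` on `[0, T) × U` is the restriction of `F`. -/
def Represents (f : smoothFunctions T U) (F : ℝ × E n → ℝ) : Prop :=
  ∀ z (hz : z ∈ Ico 0 T ×ˢ U), F z = f.1 ⟨z, hz⟩

lemma exists_represents (f : smoothFunctions T U) :
    ∃ F, Represents f F := by
  obtain ⟨F, -, h⟩ := f.2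
  exact ⟨F, fun z hz => h ⟨z, hz⟩⟩

lemma Represents.contDiffOn {f : smoothFunctions T U} {F : ℝ × E n → ℝ} (h : Represents f F) :
    ContDiffOn ℝ ∞ F (Ico 0 T ×ˢ U) := by
  obtain ⟨F', hF', h'⟩ := f.2
  exact hF'.congr fun z hz => by rw [h z hz, h' ⟨z, hz⟩]

lemma exists_of_contDiffOn {F : ℝ × E n → ℝ} (hF : ContDiffOn ℝ ∞ F (Ico 0 T ×ˢ U)) :
    ∃ f : smoothFunctions T U, Represents f F :=
  ⟨⟨fun z => F z, F, hF, fun _ => rfl⟩, fun _ _ => rfl⟩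

/-- Evaluation at a point of `[0, T) × U`. -/
def evalAt (z : ℝ × E n) (hz : z ∈ Ico 0 T ×ˢ U) : smoothFunctions T U →ₐ[ℝ] ℝ :=
  (Pi.evalAlgHom ℝ (fun _ => ℝ) ⟨z, hz⟩).comp (smoothFunctions T U).val

lemma represents_iff {f : smoothFunctions T U} {F : ℝ × E n → ℝ} :
    Represents f F ↔ ∀ z hz, F z = evalAt z hz f := Iff.rfl

lemma smooth_ext {f f' : smoothFunctions T U} (h : ∀ z hz, evalAt z hz f = evalAt z hz f') :
    f = f' := by
  ext ⟨z, hz⟩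
  exact h z hz

lemma isUnit_of_forall_ne_zero (f : smoothFunctions T U) (hf : ∀ z hz, evalAt z hz f ≠ 0) :
    IsUnit f := by
  obtain ⟨F, hF⟩ := exists_represents f
  obtain ⟨f', hf'⟩ := exists_of_contDiffOn
    (hF.contDiffOn.inv fun z hz => by rw [represents_iff.1 hF z hz]; exact hf z hz)
  refine IsUnit.of_mul_eq_one f' (smooth_ext fun z hz => ?_)
  rw [map_mul, map_one, ← represents_iff.1 hF z hz, ← represents_iff.1 hf' z hz]
  exact mul_inv_cancel₀ (by rw [represents_iff.1 hF z hz]; exact hf z hz)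

lemma uniqueDiffOn_slab (hU : IsOpen U) : UniqueDiffOn ℝ (Ico 0 T ×ˢ U) :=
  (uniqueDiffOn_Ico 0 T).prod hU.uniqueDiffOn

lemma slab_subset_closure_interior (hU : IsOpen U) :
    Ico 0 T ×ˢ U ⊆ closure (interior (Ico 0 T ×ˢ U)) := by
  rintro ⟨t, y⟩ ⟨ht, hy⟩
  rw [interior_prod_eq, interior_Ico, hU.interior_eq, closure_prod_eq,
    closure_Ioo (ht.1.trans_lt ht.2).ne]
  exact ⟨Ico_subset_Icc_self ht, subset_closure hy⟩

lemma contDiffOn_dir (hU : IsOpen U) {F : ℝ × E n → ℝ}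
    (hF : ContDiffOn ℝ ∞ F (Ico 0 T ×ˢ U)) (v : ℝ × E n) :
    ContDiffOn ℝ ∞ (fun z => fderivWithin ℝ F (Ico 0 T ×ˢ U) z v) (Ico 0 T ×ˢ U) :=
  (hF.fderivWithin (uniqueDiffOn_slab hU) (by norm_cast)).clm_apply contDiffOn_const

lemma exists_dir (hU : IsOpen U) (v : ℝ × E n) (f : smoothFunctions T U) :
    ∃ f' : smoothFunctions T U, ∀ F, Represents f F →
      Represents f' (fun z => fderivWithin ℝ F (Ico 0 T ×ˢ U) z v) := by
  obtain ⟨F, hF⟩ := exists_represents f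
  obtain ⟨f', hf'⟩ := exists_of_contDiffOn (contDiffOn_dir hU hF.contDiffOn v)
  refine ⟨f', fun F' hF' z hz => ?_⟩
  rw [← hf' z hz]
  have h : EqOn F' F (Ico 0 T ×ˢ U) := fun x hx => by rw [hF x hx, hF' x hx]
  exact congrArg (fun L : (ℝ × E n) →L[ℝ] ℝ => L v) (fderivWithin_congr' h hz)

variable (hU : IsOpen U)

/-- The derivative in the constant direction `v`, within `[0, T) × U`. -/
def dirFun (v : ℝ × E n) (f : smoothFunctions T U) : smoothFunctions T U :=
  (exists_dir hU v f).choose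

lemma dirFun_spec (v : ℝ × E n) {f : smoothFunctions T U} {F : ℝ × E n → ℝ} (h : Represents f F) :
    Represents (dirFun hU v f) (fun z => fderivWithin ℝ F (Ico 0 T ×ˢ U) z v) :=
  (exists_dir hU v f).choose_spec F h

lemma Represents.differentiableWithinAt {f : smoothFunctions T U} {F : ℝ × E n → ℝ}
    (h : Represents f F) {z : ℝ × E n} (hz : z ∈ Ico 0 T ×ˢ U) :
    DifferentiableWithinAt ℝ F (Ico 0 T ×ˢ U) z :=
  (h.contDiffOn.differentiableOn (by simp)) z hz

/-- The derivative in the constant direction `v` as a derivation of the smooth functions. -/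
def dirDeriv (v : ℝ × E n) : Derivation ℝ (smoothFunctions T U) (smoothFunctions T U) :=
  Derivation.mk'
    { toFun := dirFun hU v
      map_add' := fun f f' => smooth_ext fun z hz => by
        obtain ⟨F, hF⟩ := exists_represents f
        obtain ⟨F', hF'⟩ := exists_represents f'
        have h : Represents (f + f') (F + F') := fun z hz => by
          simp [hF z hz, hF' z hz]
        rw [map_add, ← represents_iff.1 (dirFun_spec hU v h) z hz,
          ← represents_iff.1 (dirFun_spec hU v hF) z hz,
          ← represents_iff.1 (dirFun_spec hU v hF') z hz,
          fderivWithin_add (uniqueDiffOn_slab hU z hz) (hF.differentiableWithinAt hz)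
            (hF'.differentiableWithinAt hz)]
        rfl
      map_smul' := fun c f => smooth_ext fun z hz => by
        obtain ⟨F, hF⟩ := exists_represents f
        have h : Represents (c • f) (c • F) := fun z hz => by
          simp [hF z hz]
        rw [RingHom.id_apply, map_smul, ← represents_iff.1 (dirFun_spec hU v h) z hz,
          ← represents_iff.1 (dirFun_spec hU v hF) z hz,
          fderivWithin_const_smul (uniqueDiffOn_slab hU z hz) (hF.differentiableWithinAt hz)]
        rfl }
    fun f f' => smooth_ext fun z hz => by
      obtain ⟨F, hF⟩ := exists_represents f
      obtain ⟨F', hF'⟩ := exists_represents f'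
      have h : Represents (f * f') (F * F') := fun z hz => by
        simp [hF z hz, hF' z hz]
      change evalAt z hz (dirFun hU v (f * f'))
        = evalAt z hz (f * dirFun hU v f' + f' * dirFun hU v f)
      rw [map_add, map_mul, map_mul, ← represents_iff.1 (dirFun_spec hU v h) z hz,
        ← represents_iff.1 (dirFun_spec hU v hF) z hz,
        ← represents_iff.1 (dirFun_spec hU v hF') z hz, ← represents_iff.1 hF z hz,
        ← represents_iff.1 hF' z hz,
        fderivWithin_mul (uniqueDiffOn_slab hU z hz) (hF.differentiableWithinAt hz)
            (hF'.differentiableWithinAt hz)]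
      rfl

lemma dirDeriv_spec (v : ℝ × E n) {f : smoothFunctions T U} {F : ℝ × E n → ℝ}
    (h : Represents f F) :
    Represents (dirDeriv hU v f) (fun z => fderivWithin ℝ F (Ico 0 T ×ˢ U) z v) :=
  dirFun_spec hU v h

/-- Second derivatives commute, also at the initial time, as `[0, T) × U` lies in the closure of its
interior. -/
lemma dirDeriv_comm (v w : ℝ × E n) (f : smoothFunctions T U) :
    dirDeriv hU v (dirDeriv hU w f) = dirDeriv hU w (dirDeriv hU v f) := by
  refine smooth_ext fun z hz => ?_
  obtain ⟨F, hF⟩ := exists_represents f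
  have key : ∀ v w : ℝ × E n, evalAt z hz (dirDeriv hU v (dirDeriv hU w f))
      = fderivWithin ℝ (fderivWithin ℝ F (Ico 0 T ×ˢ U)) (Ico 0 T ×ˢ U) z v w := by
    intro v w
    rw [← represents_iff.1 (dirDeriv_spec hU v (dirDeriv_spec hU w hF)) z hz,
      fderivWithin_clm_apply (uniqueDiffOn_slab hU z hz)
        (((hF.contDiffOn.fderivWithin (m := ∞) (uniqueDiffOn_slab hU) (by
          norm_cast)).differentiableOn
          (by simp)) z hz) (differentiableWithinAt_const w)]
    simp
  rw [key, key]
  exact (hF.contDiffOn z hz).isSymmSndFDerivWithinAt (by simp; norm_cast) (uniqueDiffOn_slab hU)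
    (slab_subset_closure_interior hU hz) hz v w

lemma represents_timeDeriv {f : smoothFunctions T U} {F : ℝ × E n → ℝ} (h : Represents f F) :
    Represents (dirDeriv hU (1, 0) f) (timeDeriv T F) := by
  intro z hz
  rw [← dirDeriv_spec hU (1, 0) h z hz]
  have h1 := (h.differentiableWithinAt hz).hasFDerivWithinAt
  have h2 : HasDerivWithinAt (fun s : ℝ => (s, z.2)) ((1 : ℝ), (0 : E n)) (Ico 0 T) z.1 :=
    (hasDerivWithinAt_id _ _).prodMk (hasDerivWithinAt_const _ _ _)
  exact (HasFDerivWithinAt.comp_hasDerivWithinAt (t := Ico 0 T ×ˢ U) z.1 h1 h2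
    (fun s hs => ⟨hs, hz.2⟩)).derivWithin (uniqueDiffOn_Ico 0 T z.1 hz.1)

lemma represents_spaceDeriv {f : smoothFunctions T U} {F : ℝ × E n → ℝ} (h : Represents f F)
    (a : Fin n) :
    Represents (dirDeriv hU (0, EuclideanSpace.single a 1) f) (spaceDeriv a F) := by
  intro z hz
  rw [← dirDeriv_spec hU _ h z hz]
  have h1 := (h.differentiableWithinAt hz).hasFDerivWithinAt
  have h2 : HasFDerivWithinAt (fun y : E n => (z.1, y)) (ContinuousLinearMap.inr ℝ ℝ (E n)) U z.2 :=
    (hasFDerivWithinAt_const _ _ _).prodMk (hasFDerivWithinAt_id _ _)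
  have h3 := (HasFDerivWithinAt.comp (t := Ico 0 T ×ˢ U) z.2 h1 h2
    (fun y hy => ⟨hz.1, hy⟩)).hasFDerivAt (hU.mem_nhds hz.2)
  change fderiv ℝ (F ∘ fun y => (z.1, y)) z.2 _ = _
  rw [h3.fderiv]
  rfl

end SmoothFunctions

/-! ### Comparison of the algebraic and the analytic tensor calculus -/

variable {n : ℕ} {T : ℝ} {U : Set (E n)}

section Represents

variable {f f' : smoothFunctions T U} {F F' : ℝ × E n → ℝ}

lemma Represents.add (h : Represents f F) (h' : Represents f' F') :
    Represents (f + f') (fun z => F z + F' z) := fun z hz => by simp [h z hz, h' z hz]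

lemma Represents.sub (h : Represents f F) (h' : Represents f' F') :
    Represents (f - f') (fun z => F z - F' z) := fun z hz => by simp [h z hz, h' z hz]

lemma Represents.mul (h : Represents f F) (h' : Represents f' F') :
    Represents (f * f') (fun z => F z * F' z) := fun z hz => by simp [h z hz, h' z hz]

lemma Represents.neg (h : Represents f F) : Represents (-f) (fun z => -F z) :=
  fun z hz => by simp [h z hz]

lemma Represents.smul (c : ℝ) (h : Represents f F) : Represents (c • f) (fun z => c * F z) :=
  fun z hz => by simp [h z hz]

lemma Represents.zero : Represents (0 : smoothFunctions T U) (fun _ => 0) := fun z hz => by simp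

lemma Represents.sum {κ : Type*} [Fintype κ] {f : κ → smoothFunctions T U}
    {F : κ → ℝ × E n → ℝ} (h : ∀ k, Represents (f k) (F k)) :
    Represents (∑ k, f k) (fun z => ∑ k, F k z) := fun z hz => by
  change _ = evalAt z hz _
  rw [map_sum]
  exact Finset.sum_congr rfl fun k _ => h k z hz

lemma Represents.congr (h : Represents f F) (e : f' = f) : Represents f' F := e ▸ h

end Represents

/-- The algebraic geometry `G` over the smooth functions is the restriction to `[0, T) × U` of the
geometry `L`. -/
structure Models {ι : Type} [Fintype ι] (G : FrameGeometry ι (smoothFunctions T U))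
    (L : LocalGeometry ι (ℝ × E n)) : Prop where
  D : ∀ a {f F}, Represents f F → Represents (G.D a f) (L.D a F)
  Γ : ∀ a b c, Represents (G.Γ a b c) (L.Γ a b c)
  ginv : ∀ a b, Represents (G.ginv a b) (L.ginv a b)

namespace Models

open FrameGeometry

variable {ι : Type} [Fintype ι] {G : FrameGeometry ι (smoothFunctions T U)}
  {L : LocalGeometry ι (ℝ × E n)}

lemma nabla1 (H : Models G L) {s : ι → smoothFunctions T U} {S : ι → ℝ × E n → ℝ}
    (h : ∀ i, Represents (s i) (S i)) (a i : ι) :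
    Represents (G.scalarConn.lower.nab a s i) (L.nabla1 S a i) :=
  (H.D a (h i)).sub (.sum fun p => (H.Γ a i p).mul (h p))

lemma nabla2 (H : Models G L) {s : ι → ι → smoothFunctions T U}
    {S : ι → ι → ℝ × E n → ℝ}
    (h : ∀ i j, Represents (s i j) (S i j)) (a i j : ι) :
    Represents (G.scalarConn.lower.lower.nab a s i j) (L.nabla2 S a i j) :=
  (((H.D a (h i j)).sub (.sum fun p => (H.Γ a i p).mul (h p j))).sub
    (.sum fun p => (H.Γ a j p).mul (h i p))).congr (by
      simp only [Connection.lower_nab, Pi.sub_apply, Finset.sum_apply, Pi.smul_apply, smul_eq_mul,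
        scalarConn_nab]
      ring)

lemma nabla3 (H : Models G L) {s : ι → ι → ι → smoothFunctions T U}
    {S : ι → ι → ι → ℝ × E n → ℝ}
    (h : ∀ b i j, Represents (s b i j) (S b i j)) (a b i j : ι) :
    Represents (G.scalarConn.lower.lower.lower.nab a s b i j) (L.nabla3 S a b i j) :=
  ((((H.D a (h b i j)).sub (.sum fun p => (H.Γ a b p).mul (h p i j))).sub
    (.sum fun p => (H.Γ a i p).mul (h b p j))).sub
    (.sum fun p => (H.Γ a j p).mul (h b i p))).congr (by
      simp only [Connection.lower_nab, Pi.sub_apply, Finset.sum_apply, Pi.smul_apply, smul_eq_mul,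
        scalarConn_nab]
      ring)

lemma tr (H : Models G L) {s : ι → ι → smoothFunctions T U}
    {S : ι → ι → ℝ × E n → ℝ}
    (h : ∀ i j, Represents (s i j) (S i j)) :
    Represents (G.tr s) (fun z => ∑ p, ∑ q, L.ginv p q z * S p q z) :=
  .sum fun p => .sum fun q => (H.ginv p q).mul (h p q)

lemma laplacian (H : Models G L) {s : ι → ι → smoothFunctions T U}
    {S : ι → ι → ℝ × E n → ℝ}
    (h : ∀ i j, Represents (s i j) (S i j)) (i j : ι) :
    Represents (G.scalarConn.lower.lower.lap s i j) (L.laplacian S i j) :=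
  (H.tr fun a b => H.nabla3 (H.nabla2 h) a b i j).congr (by
    rw [Connection.lap, Connection.div, tr_apply, tr_apply]; rfl)

lemma riemann (H : Models G L) (i j k l : ι) :
    Represents (G.riem i j k l) (L.riemann i j k l) :=
  (((H.D i (H.Γ j k l)).sub (H.D j (H.Γ i k l))).add
    (.sum fun p => (H.Γ j k p).mul (H.Γ i p l))).sub
    (.sum fun p => (H.Γ i k p).mul (H.Γ j p l))

lemma ricci (H : Models G L) (j k : ι) : Represents (G.ric j k) (L.ricci j k) :=
  .sum fun p => H.riemann p j k p

lemma curvatureTerm (H : Models G L) {s : ι → ι → smoothFunctions T U}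
    {S : ι → ι → ℝ × E n → ℝ}
    (h : ∀ i j, Represents (s i j) (S i j)) (i j : ι) :
    Represents (G.curvTerm s i j) (L.curvatureTerm S i j) :=
  .sum fun p => .sum fun r => .sum fun q => ((H.ginv p r).mul (h r q)).mul (H.riemann p i j q)

lemma div2 (H : Models G L) {s : ι → ι → smoothFunctions T U}
    {S : ι → ι → ℝ × E n → ℝ}
    (h : ∀ i j, Represents (s i j) (S i j)) (j : ι) :
    Represents (G.scalarConn.lower.div s j) (L.div2 S j) :=
  (H.tr fun p q => H.nabla2 h p q j).congr (by rw [Connection.div, tr_apply])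

lemma div1 (H : Models G L) {s : ι → smoothFunctions T U} {S : ι → ℝ × E n → ℝ}
    (h : ∀ i, Represents (s i) (S i)) :
    Represents (G.scalarConn.div s) (L.div1 S) :=
  H.tr fun p q => H.nabla1 h p q

lemma sharp (H : Models G L) {s : ι → smoothFunctions T U} {S : ι → ℝ × E n → ℝ}
    (h : ∀ i, Represents (s i) (S i)) (k : ι) :
    Represents (G.sharp s k) (fun z => ∑ p, L.ginv k p z * S p z) :=
  .sum fun p => (H.ginv k p).mul (h p)

lemma scalar (H : Models G L) : Represents (∑ e, G.mixedRic e e) L.scalar :=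
  (Represents.sum fun e => .sum fun p => (H.ginv e p).mul (H.ricci e p)).congr
    (Finset.sum_congr rfl fun e _ => mixedRic_eq_sharp e e)

lemma ricciDot (H : Models G L) {s : ι → ι → smoothFunctions T U}
    {S : ι → ι → ℝ × E n → ℝ}
    (h : ∀ i j, Represents (s i j) (S i j)) :
    Represents (G.tr fun p q => contract (G.mixedRic p) (s q)) (L.ricciDot S) :=
  (Represents.sum fun i => .sum fun j => .sum fun p => .sum fun q =>
    (((H.ginv i p).mul (H.ginv j q)).mul (H.ricci i j)).mul (h p q)).congr (by
    simp only [FrameGeometry.tr, contract, mixedRic_eq_sharp, FrameGeometry.sharp, smul_eq_mul,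
      Finset.mul_sum,
      Finset.sum_mul]
    refine Finset.sum_congr rfl fun i _ => ?_
    rw [Finset.sum_congr rfl fun _ _ => Finset.sum_comm, Finset.sum_comm]
    refine Finset.sum_congr rfl fun j _ => Finset.sum_congr rfl fun p _ =>
      Finset.sum_congr rfl fun q _ => ?_
    rw [G.ginv_symm q j]
    ring)

end Models

/-! ### Ricci flow in a chart -/

section Chart

variable {M : Type*} [TopologicalSpace M] [ChartedSpace (E n) M] {e : OpenPartialHomeomorph M (E n)}

lemma sum_coordVector (y : E n) (v : Fin n → ℝ) :
    ∑ i, v i • coordVector e y i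
      = mfderiv (𝓡 n) (𝓡 n) e.symm y (∑ i, v i • (EuclideanSpace.single i (1 : ℝ) : E n)) := by
  let L : E n →L[ℝ] TangentSpace (𝓡 n) (e.symm y) := mfderiv (𝓡 n) (𝓡 n) e.symm y
  change ∑ i, v i • L (EuclideanSpace.single i 1) = L (∑ i, v i • EuclideanSpace.single i 1)
  simp only [map_sum, map_smul]

variable [IsManifold (𝓡 n) ∞ M] (g : TimeMetric n M)

/-- The matrix of the metric in the chart `e`. -/
def gram (g : TimeMetric n M) (e : OpenPartialHomeomorph M (E n)) (z : ℝ × E n) :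
    Matrix (Fin n) (Fin n) ℝ := Matrix.of fun a b => components e g.tensor a b z

lemma gram_isSymm (z : ℝ × E n) : (gram g e z).IsSymm := by
  ext i j
  exact (g z.1).symm _ _ _

lemma gram_det_ne_zero (he : e ∈ IsManifold.maximalAtlas (𝓡 n) ∞ M) {z : ℝ × E n}
    (hz : z.2 ∈ e.target) : (gram g e z).det ≠ 0 := by
  intro hdet
  obtain ⟨v, hv, hMv⟩ := Matrix.exists_mulVec_eq_zero_iff.2 hdet
  have hmd : e.MDifferentiable (𝓡 n) (𝓡 n) :=
    ⟨(contMDiffOn_of_mem_maximalAtlas he).mdifferentiableOn (by simp),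
      (contMDiffOn_symm_of_mem_maximalAtlas he).mdifferentiableOn (by simp)⟩
  have hinj := hmd.symm.mfderiv_injective (x := z.2) hz
  have hw : (∑ i, v i • coordVector e z.2 i) ≠ 0 := by
    rw [sum_coordVector]
    intro h0
    apply hv
    have h1 : (∑ i, v i • (EuclideanSpace.single i (1 : ℝ) : E n)) = 0 :=
      hinj (h0.trans (map_zero _).symm)
    funext i
    have := congrArg (fun w : E n => w i) h1
    simpa [Pi.single_apply] using this
  have hpos := (g z.1).pos _ _ hw
  have h0 : (g z.1).inner _ (∑ i, v i • coordVector e z.2 i) (∑ i, v i • coordVector e z.2 i)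
      = v ⬝ᵥ (gram g e z).mulVec v := by
    simp only [map_sum, map_smul, sum_apply, smul_apply,
      Matrix.mulVec, dotProduct, smul_eq_mul]
    refine Finset.sum_congr rfl fun i _ => ?_
    congr 1
    refine Finset.sum_congr rfl fun j _ => ?_
    rw [mul_comm, (g z.1).symm]
    rfl
  rw [h0, hMv, dotProduct_zero] at hpos
  exact lt_irrefl _ hpos

open FrameGeometry

/-- In a chart, a Ricci flow and its space-time geometry come from an algebraic Ricci flow over the
ring of smooth functions. -/
lemma exists_geometry (hg : IsRicciFlow T g) (he : e ∈ IsManifold.maximalAtlas (𝓡 n) ∞ M) :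
    ∃ (G : FrameGeometry (Fin n) (smoothFunctions T e.target)) (F : G.TimeEvolution),
      Models G (space g e) ∧ Models F.extend (spaceTime T g e) := by
  choose γ hγ using fun i j => exists_of_contDiffOn (hg.1 e he i j)
  have hmap : ∀ z hz, (evalAt z hz).mapMatrix (Matrix.of γ) = gram g e z := fun z hz => by
    ext i j
    exact (represents_iff.1 (hγ i j) z hz).symm
  have hdet : IsUnit (Matrix.of γ).det := by
    refine isUnit_of_forall_ne_zero _ fun z hz => ?_
    rw [AlgHom.map_det, hmap]
    exact gram_det_ne_zero g he hz.2
  have hsymm : (Matrix.of γ).IsSymm := by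
    ext i j : 1
    refine smooth_ext fun z hz => ?_
    have := congrFun (congrFun (gram_isSymm g (e := e) z) i) j
    rw [← hmap z hz] at this
    exact this
  have hinv : ∀ i j, Represents ((Matrix.of γ)⁻¹ i j) (inverseMetric g e i j) := by
    intro i j z hz
    have h1 : (evalAt z hz).mapMatrix (Matrix.of γ)⁻¹ * gram g e z = 1 := by
      rw [← hmap z hz, ← map_mul, Matrix.nonsing_inv_mul _ hdet, map_one]
    have h2 := Matrix.inv_eq_left_inv h1
    exact congrFun (congrFun h2 i) j
  set D : Fin n → Derivation ℝ (smoothFunctions T e.target) (smoothFunctions T e.target) :=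
    fun a => dirDeriv e.open_target (0, EuclideanSpace.single a 1) with hD
  set G := leviCivita D (fun a b f => dirDeriv_comm _ _ _ f) (Matrix.of γ) hdet hsymm with hG
  have HG : Models G (space g e) :=
    { D := fun a f F h => represents_spaceDeriv e.open_target h a
      Γ := fun i j k => .smul _ <| .sum fun l => (hinv k l).mul <|
        ((represents_spaceDeriv e.open_target (hγ j l) i).add
          (represents_spaceDeriv e.open_target (hγ i l) j)).sub
          (represents_spaceDeriv e.open_target (hγ i j) l)
      ginv := hinv }
  set D0 : Derivation ℝ (smoothFunctions T e.target) (smoothFunctions T e.target) :=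
    dirDeriv e.open_target (1, 0) with hD0
  have hflow : ∀ i j, D0 (γ i j) = (-2 : ℝ) • G.ric i j := by
    intro i j
    refine smooth_ext fun z hz => ?_
    rw [← represents_iff.1 (represents_timeDeriv e.open_target (hγ i j)) z hz, map_smul,
      ← represents_iff.1 (HG.ricci i j) z hz]
    exact hg.2 e he z.1 hz.1 z.2 hz.2 i j
  set F : G.TimeEvolution :=
    .ofRicciFlow D0 (fun a f => dirDeriv_comm _ _ _ f) hflow with hF
  have hrho : ∀ i k, Represents (G.mixedRic i k) (mixedRicci g e i k) := fun i k =>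
    (HG.sharp (HG.ricci i) k).congr (mixedRic_eq_sharp i k)
  refine ⟨G, F, HG, ?_, ?_, ?_⟩
  · intro a f F' h
    cases a using Fin.cases with
    | zero => exact represents_timeDeriv e.open_target h
    | succ i => exact represents_spaceDeriv e.open_target h i
  · intro a b c
    cases c using Fin.cases with
    | zero => exact .zero
    | succ k =>
      cases a using Fin.cases with
      | zero =>
        cases b using Fin.cases with
        | zero =>
          exact ((HG.sharp (fun p => HG.D p HG.scalar) k).smul (-(1 / 2))).congr (neg_smul _ _).symm
        | succ j => exact (hrho j k).neg
      | succ i =>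
        cases b using Fin.cases with
        | zero => exact (hrho i k).neg
        | succ j => exact HG.Γ i j k
  · intro a b
    cases a using Fin.cases with
    | zero => exact .zero
    | succ i =>
      cases b using Fin.cases with
      | zero => exact .zero
      | succ j => exact HG.ginv i j

/-- For a symmetric 2-tensor, `∇̃_0 S_{ij} = ∂_t S_{ij} + g̃^{qr} R̃_{iq} S_{jr} + g̃^{qr} R̃_{jq}
S_{ir}`, since `Γ̃_{0i}^r = -g̃^{qr} R̃_{iq}`. Symmetry is only required at the point in question.
-/
lemma nabla2_time_eq {G : FrameGeometry (Fin n) (smoothFunctions T e.target)} (F : G.TimeEvolution)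
    (H : Models F.extend (spaceTime T g e)) {z : ℝ × E n} (hz : z ∈ Ico 0 T ×ˢ e.target)
    (S : Fin (n + 1) → Fin (n + 1) → ℝ × E n → ℝ) (hS : ∀ a b, S a b z = S b a z)
    (i j : Fin (n + 1)) :
    (spaceTime T g e).nabla2 S 0 i j z = timeDeriv T (S i j) z
      + ∑ q, ∑ r, (spaceTime T g e).ginv q r z * (spaceTime T g e).ricci i q z * S j r z
      + ∑ q, ∑ r, (spaceTime T g e).ginv q r z * (spaceTime T g e).ricci j q z * S i r z := by
  have hΓ : ∀ i r, (spaceTime T g e).Γ 0 i r z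
      = -∑ q, (spaceTime T g e).ginv q r z * (spaceTime T g e).ricci i q z := by
    intro i r
    have h : F.extend.Γ 0 i r = - ∑ q, F.extend.ginv q r * F.extend.ric i q := by
      rw [F.extend.Γ_symm]
      refine (F.extend_Γ_zero i r).trans ?_
      rw [mixedRic_eq_sharp, sharp]
      simp only [F.extend.ginv_symm r, smul_eq_mul]
    exact ((H.Γ 0 i r) z hz).trans ((((Represents.sum fun q =>
      (H.ginv q r).mul (H.ricci i q)).neg).congr h) z hz).symm
  have hsum : ∀ i j, ∑ r, (spaceTime T g e).Γ 0 i r z * S j r z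
      = - ∑ q, ∑ r, (spaceTime T g e).ginv q r z * (spaceTime T g e).ricci i q z * S j r z := by
    intro i j
    rw [Finset.sum_comm]
    simp only [hΓ, neg_mul, Finset.sum_neg_distrib, Finset.sum_mul]
  change timeDeriv T (S i j) z - ∑ p, (spaceTime T g e).Γ 0 i p z * S p j z
    - ∑ p, (spaceTime T g e).Γ 0 j p z * S i p z = _
  simp only [hS _ j, hsum]
  ring

end Chart

end

end RicciSpaceTime

open RicciSpaceTime RicciSpaceTime.FrameGeometry in
theorem proposition2p3 {n : ℕ} {M : Type*} [TopologicalSpace M]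
    [ChartedSpace (EuclideanSpace ℝ (Fin n)) M] [IsManifold (𝓡 n) ∞ M]
    (T : ℝ) (g : TimeMetric n M) (hg : IsRicciFlow T g)
    (h : TimeTensor n M) (hh : IsLichnerowiczHeatFlow T g h) :
    ∀ e ∈ IsManifold.maximalAtlas (𝓡 n) ∞ M, ∀ t ∈ Ico 0 T, ∀ y ∈ e.target,
      ∀ i j : Fin (n + 1),
        ((spaceTime T g e).nabla2 (extension g h e) 0 i j (t, y)
          = (spaceTime T g e).laplacian (extension g h e) i j (t, y)
            + 2 * (spaceTime T g e).curvatureTerm (extension g h e) i j (t, y)) ∧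
        (timeDeriv T (extension g h e i j) (t, y)
          = (spaceTime T g e).lichnerowicz (extension g h e) i j (t, y)) ∧
        -- the two equations are equivalent for every symmetric space-time 2-tensor
        (∀ S : Fin (n + 1) → Fin (n + 1) → ℝ × EuclideanSpace ℝ (Fin n) → ℝ,
          (∀ a b, S a b = S b a) →
          ((spaceTime T g e).nabla2 S 0 i j (t, y)
              = (spaceTime T g e).laplacian S i j (t, y)
                + 2 * (spaceTime T g e).curvatureTerm S i j (t, y) ↔
            timeDeriv T (S i j) (t, y) = (spaceTime T g e).lichnerowicz S i j (t, y))) := by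
  intro e he t ht y hy i j
  obtain ⟨G, F, HG, HF⟩ := exists_geometry g hg he
  have hz : (t, y) ∈ Ico 0 T ×ˢ e.target := ⟨ht, hy⟩
  choose s hs using fun i j => exists_of_contDiffOn (hh.1 e he i j)
  have hss : ∀ i j, s i j = s j i := fun i j => smooth_ext fun z hz => by
    rw [← represents_iff.1 (hs i j) z hz, ← represents_iff.1 (hs j i) z hz]
    exact hh.2.1 z.1 hz.1 _ _ _
  have hflow : ∀ i j, F.D0 (s i j) = G.scalarConn.lower.lower.lap s i j + 2 * G.curvTerm s i j
      - ∑ p, G.mixedRic i p * s j p - ∑ p, G.mixedRic j p * s i p := by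
    intro i j
    have hrho : ∀ i j, ∑ p, G.mixedRic i p * s j p
        = ∑ q, ∑ r, G.ginv q r * G.ric i q * s j r := by
      intro i j
      rw [Finset.sum_comm]
      simp only [mixedRic_eq_sharp, sharp, smul_eq_mul, Finset.sum_mul, G.ginv_symm _ (_ : Fin n)]
    have h1 : Represents (G.scalarConn.lower.lower.lap s i j + (2 : ℝ) • G.curvTerm s i j
        - ∑ q, ∑ r, G.ginv q r * G.ric i q * s j r - ∑ q, ∑ r, G.ginv q r * G.ric j q * s i r)
        ((space g e).lichnerowicz (components e h) i j) :=
      (((HG.laplacian hs i j).add ((HG.curvatureTerm hs i j).smul 2)).sub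
        (.sum fun q => .sum fun r => ((HG.ginv q r).mul (HG.ricci i q)).mul (hs j r))).sub
        (.sum fun q => .sum fun r => ((HG.ginv q r).mul (HG.ricci j q)).mul (hs i r))
    rw [hrho, hrho, two_mul, ← two_smul ℝ (G.curvTerm s i j)]
    refine smooth_ext fun z hz => ?_
    rw [← represents_iff.1 h1 z hz]
    exact (HF.D 0 (hs i j) z hz).symm.trans (hh.2.2 e he z.1 hz.1 z.2 hz.2 i j)
  have hext : ∀ a b, Represents (F.extTensor s a b) (extension g h e a b) := by
    intro a b
    cases a using Fin.cases with
    | zero =>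
      cases b using Fin.cases with
      | zero => exact (HG.div1 (HG.div2 hs)).add (HG.ricciDot hs)
      | succ j => exact HG.div2 hs j
    | succ i =>
      cases b using Fin.cases with
      | zero => exact HG.div2 hs i
      | succ j => exact hs i j
  have hextsymm : ∀ a b, extension g h e a b (t, y) = extension g h e b a (t, y) := fun a b => by
    rw [hext a b _ hz, hext b a _ hz, F.extTensor_symm s hss]
  have hlich : ∀ S : Fin (n + 1) → Fin (n + 1) → ℝ × EuclideanSpace ℝ (Fin n) → ℝ,
      (∀ a b, S a b (t, y) = S b a (t, y)) →
      ((spaceTime T g e).nabla2 S 0 i j (t, y) = (spaceTime T g e).laplacian S i j (t, y)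
          + 2 * (spaceTime T g e).curvatureTerm S i j (t, y) ↔
        timeDeriv T (S i j) (t, y) = (spaceTime T g e).lichnerowicz S i j (t, y)) := by
    intro S hS
    rw [nabla2_time_eq g F HF hz S hS i j, LocalGeometry.lichnerowicz]
    constructor <;> intro h <;> linarith
  have hheat : (spaceTime T g e).nabla2 (extension g h e) 0 i j (t, y)
      = (spaceTime T g e).laplacian (extension g h e) i j (t, y)
        + 2 * (spaceTime T g e).curvatureTerm (extension g h e) i j (t, y) := by
    have h0 := F.heatOp_extTensor s hss hflow i j
    rw [heatOp_apply, F.contract_timeField] at h0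
    have h1 := congrArg (evalAt (t, y) hz) h0
    rw [map_sub, map_sub, map_mul, map_ofNat, map_zero,
      ← represents_iff.1 (HF.nabla2 hext 0 i j) _ hz,
      ← represents_iff.1 (HF.laplacian hext i j) _ hz,
      ← represents_iff.1 (HF.curvatureTerm hext i j) _ hz] at h1
    linarith
  exact ⟨hheat, (hlich _ hextsymm).1 hheat, fun S hS => hlich S fun a b => by rw [hS]⟩
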